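/- Call a finite simple graph planar if it can be drawn on the sphere without crossings, and toroidal if it can be drawn on the torus (the sphere with one handle) without crossings. Let $G$ be a simple graph with exactly 12 vertices such that $G$ is planar and its complement $\overline{G}$ is toroidal; that is, $(G,\overline{G})$ is a decomposition of $K_{12}$ into a planar graph and a toroidal graph (the pair is then called PT12). Then $G$ has no separating triangle whose deletion leaves subgraphs of orders 3 and 6. That is, there is no set $A$ of three mutually adjacent vertices of $G$ such that $G-A$ is disconnected and the remaining nine vertices can be partitioned into a set $B$ of 3 vertices and a set $C$ of 6 vertices (neither required to induce a connected subgraph) with no edge of $G$ between $B$ and $C$. -/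

import Mathlib

namespace PlaneTorus

variable {V : Type*}

/-- A rotation system of a simple graph `G`: for every vertex `v`, a cyclic ordering of the darts
(directed edges) leaving `v`. It is encoded by one permutation of all darts whose orbits are
exactly the sets of darts with a common initial vertex. By the Heffter–Edmonds principle this is
a graph embedding (of each connected component of `G`, with 2-cell regions) in an orientable
surface. -/
structure RotationSystem (G : SimpleGraph V) where
  /-- The next dart in the cyclic order around the initial vertex. -/
  next : Equiv.Perm G.Dart
  sameCycle_iff : ∀ d e : G.Dart, next.SameCycle d e ↔ d.fst = e.fst

/-- Reversal of darts, as a permutation. -/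
def dartReversal (G : SimpleGraph V) : Equiv.Perm G.Dart where
  toFun d := d.symm
  invFun d := d.symm
  left_inv d := d.symm_symm
  right_inv d := d.symm_symm

namespace RotationSystem

variable {G : SimpleGraph V}

/-- Face tracing: traverse the dart `d`, then leave its end along the dart that follows the
reversed dart in the rotation there. -/
def facePerm (R : RotationSystem G) : Equiv.Perm G.Dart :=
  R.next * dartReversal G

/-- The number of regions of the embedding, summed over the connected components of `G`: one for
every orbit of face tracing, and one for every isolated vertex (the sphere minus a point). -/
noncomputable def numRegions (R : RotationSystem G) : ℕ :=
  Nat.card (Quotient (Equiv.Perm.SameCycle.setoid R.facePerm)) +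
    Nat.card {v : V // ∀ w, ¬ G.Adj v w}

/-- The embedding given by `R` has total genus `h`. If the connected components of `G` are embedded
in surfaces of genera `h₁, …, h_c`, then Euler's formula `Vᵢ - Eᵢ + Fᵢ = 2 - 2 hᵢ` for each of
them gives `V - E + F = 2 c - 2 h` with `h = h₁ + … + h_c`; the connected sum of these surfaces
is the sphere with `h` handles. -/
def HasGenus (R : RotationSystem G) (h : ℕ) : Prop :=
  (Nat.card V : ℤ) - Nat.card G.edgeSet + R.numRegions =
    2 * Nat.card G.ConnectedComponent - 2 * h

end RotationSystem

/-- The finite graph `G` can be drawn without crossings on the sphere with `g` handles. Regions of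
such a drawing need not be 2-cells, which is why all genera `h ≤ g` are admitted. -/
def EmbedsInSurface (G : SimpleGraph V) (g : ℕ) : Prop :=
  ∃ (R : RotationSystem G) (h : ℕ), h ≤ g ∧ R.HasGenus h

/-- A planar graph: it can be drawn on the sphere without crossings. -/
def IsPlanar (G : SimpleGraph V) : Prop := EmbedsInSurface G 0

/-- A toroidal graph: it can be drawn on the torus without crossings. -/
def IsToroidal (G : SimpleGraph V) : Prop := EmbedsInSurface G 1

/-- The pair `(G, Gᶜ)` is PT12: `G` is planar, its complement is toroidal, and together they
decompose the complete graph on 12 vertices. -/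
structure IsPT12 [Fintype V] (G : SimpleGraph V) : Prop where
  card_eq : Fintype.card V = 12
  planar : IsPlanar G
  toroidal_compl : IsToroidal Gᶜ

/-- `A` is the vertex set of a separating triangle of `G`: its three vertices are mutually adjacent
and `G - A` is disconnected. -/
def IsSeparatingTriangle (G : SimpleGraph V) (A : Finset V) : Prop :=
  G.IsNClique 3 A ∧ ¬ (G.induce {v | v ∉ A}).Preconnected

/-- `G - A` splits into two (not necessarily connected) subgraphs of orders `p` and `q` with no edge
between them. -/
def DeletionLeaves (G : SimpleGraph V) (A : Finset V) (p q : ℕ) : Prop :=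
  ∃ B C : Finset V, Disjoint B C ∧ (∀ v, v ∉ A ↔ v ∈ B ∨ v ∈ C) ∧
    B.card = p ∧ C.card = q ∧ ∀ b ∈ B, ∀ c ∈ C, ¬ G.Adj b c

end PlaneTorus

/-! The complement contains the complete bipartite graph between `B` and `C`, a K₃,₆, which nearly
exhausts the torus. Euler's formula for bipartite subgraphs of the complement shows that each vertex
of the triangle `A` has at least four `G`-neighbours in `C` and at least one in `B`. Now two edge
bounds meet: the planar bound on `A ∪ C` allows at most 6 edges of `G` inside `C`, and the toroidal
bound on `B ∪ C` allows at most 9 edges of the complement inside `B` and `C` together. Since `C` has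
15 pairs, both are equalities. Hence `B` is independent in the complement, `G` has 6 edges inside
`C`, and it has 12 between `A` and `C`. A sharper face count (`EmbedsInSurface.le_degIn_of_indep`)
makes `G` 2-regular on `C`.

The complement has at most 36 of the 66 edges, so `G` has at least 30 and is a triangulation of the
sphere. If `C` contained no triangle, the 12 darts inside `C` would lie on different faces with
third vertex in `A`, and these faces would account for all 12 darts from `A` to `C`; but the
rotation at a vertex of `A` has to enter `C` from outside, which uses a face of another kind
(`RotationSystem.exists_triangle`). So `C` splits into two triangles, and a vertex `a` of `A` has
neighbours in `B` and in both triangles. In a triangulation the rotation at `a` can leave each of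
these three sets only to one of the two other vertices of `A`, a different one each time
(`RotationSystem.false_of_three_sides`).

All edge bounds rest on `EmbedsInSurface.exists_rotationSystem`: a subgraph inherits a rotation
whose genus is no larger. This is proved purely with permutations, by removing one dart at a time
from its vertex (`orbitCount_detach`). -/

namespace PlaneTorus

/-! ### Orbit counts of permutations and monotonicity of the genus. -/

section Orbits

variable {D : Type*}

/-- The number of orbits of a permutation, fixed points included. -/
noncomputable def orbitCount (f : Equiv.Perm D) : ℕ :=
  Nat.card (Quotient (Equiv.Perm.SameCycle.setoid f))

/-- The partition into the orbits of the group generated by two permutations. -/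
def jointSetoid (f g : Equiv.Perm D) : Setoid D :=
  Equiv.Perm.SameCycle.setoid f ⊔ Equiv.Perm.SameCycle.setoid g

/-- The number of orbits of the group generated by two permutations. -/
noncomputable def jointOrbitCount (f g : Equiv.Perm D) : ℕ :=
  Nat.card (Quotient (jointSetoid f g))

theorem sameCycle_setoid_le {f : Equiv.Perm D} {s : Setoid D} (h : ∀ x, s x (f x)) :
    Equiv.Perm.SameCycle.setoid f ≤ s := by
  have key : ∀ (n : ℕ) x, s x ((f ^ n) x) := by
    intro n
    induction n with
    | zero => intro x; exact s.refl x
    | succ n ih =>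
      intro x
      rw [pow_succ', Equiv.Perm.mul_apply]
      exact s.trans (ih x) (h _)
  rintro x y ⟨n, rfl⟩
  cases n with
  | ofNat n => simpa using key n x
  | negSucc n =>
    refine s.symm ?_
    have := key (n + 1) ((f ^ (Int.negSucc n)) x)
    rwa [← Equiv.Perm.mul_apply, zpow_negSucc, mul_inv_cancel, Equiv.Perm.one_apply,
      ← zpow_negSucc] at this

theorem jointSetoid_le {f g : Equiv.Perm D} {s : Setoid D} (hf : ∀ x, s x (f x))
    (hg : ∀ x, s x (g x)) : jointSetoid f g ≤ s :=
  sup_le (sameCycle_setoid_le hf) (sameCycle_setoid_le hg)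

theorem jointSetoid_left (f g : Equiv.Perm D) (x : D) : jointSetoid f g x (f x) :=
  (le_sup_left : Equiv.Perm.SameCycle.setoid f ≤ jointSetoid f g)
    (show f.SameCycle x (f x) from ⟨1, by simp⟩)

theorem jointSetoid_right (f g : Equiv.Perm D) (x : D) : jointSetoid f g x (g x) :=
  (le_sup_right : Equiv.Perm.SameCycle.setoid g ≤ jointSetoid f g)
    (show g.SameCycle x (g x) from ⟨1, by simp⟩)

section Detach

open Equiv

variable [DecidableEq D] (f : Perm D) (x : D)

/-- The permutation `f` with the point `x` taken out of its orbit. -/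
def detach : Perm D := swap x (f x) * f

theorem swap_detach : swap x (f x) * detach f x = f := by
  rw [detach, swap_mul_self_mul]

theorem rel_swap {s : Setoid D} {x y : D} (h : s x y) (z : D) : s z (swap x y z) := by
  rw [swap_apply_def]
  split_ifs with h1 h2
  · rwa [h1]
  · rw [h2]; exact s.symm h
  · exact s.refl z

theorem detach_apply_self : detach f x x = x := by
  simp [detach]

theorem sameCycle_detach_iff (u v : D) :
    (detach f x).SameCycle u v ↔ u = v ∨ (u ≠ x ∧ v ≠ x ∧ f.SameCycle u v) := by
  constructor
  · intro h
    by_cases hu : u = x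
    · left
      rw [hu] at h ⊢
      exact (h.eq_of_left (detach_apply_self f x))
    by_cases hv : v = x
    · left
      rw [hv] at h ⊢
      exact (h.eq_of_right (detach_apply_self f x))
    refine Or.inr ⟨hu, hv, ?_⟩
    refine sameCycle_setoid_le (f := detach f x) (s := Perm.SameCycle.setoid f) (fun z => ?_) h
    exact Setoid.trans' _ (show f.SameCycle z (f z) from ⟨1, by simp⟩)
      (rel_swap (show f.SameCycle x (f x) from ⟨1, by simp⟩) _)
  · rintro (rfl | ⟨hu, hv, h⟩)
    · exact Perm.SameCycle.refl _ _
    by_cases hx : f x = x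
    · rwa [detach, hx, swap_self, ← Perm.one_def, one_mul]
    let t := Perm.SameCycle.setoid (detach f x)
    -- Sending `x` to the class of its successor makes `q` constant along `f`, because the detached
    -- permutation jumps over `x`.
    let q : D → Quotient t := fun u => if u = x then Quotient.mk t (f x) else Quotient.mk t u
    have hq : Perm.SameCycle.setoid f ≤ Setoid.ker q := by
      refine sameCycle_setoid_le fun z => ?_
      change q z = q (f z)
      have hstep : Quotient.mk t z = Quotient.mk t (detach f x z) :=
        Quotient.sound (show (detach f x).SameCycle z (detach f x z) from ⟨1, by simp⟩)
      by_cases hz : z = x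
      · subst hz; simp [q]
      · by_cases hfz : f z = x
        · simp only [q, hz, hfz, if_true, if_false]
          rw [hstep]
          simp [detach, hfz]
        · simp only [q, hz, hfz, if_false]
          rw [hstep]
          have : f z ≠ f x := fun he => hz (f.injective he)
          simp [detach, swap_apply_of_ne_of_ne hfz this]
    have := hq h
    change q u = q v at this
    simp only [q, hu, hv, if_false] at this
    exact Quotient.exact this

end Detach

variable [Finite D]

theorem card_quotient_le_of_le {r t : Setoid D} (h : r ≤ t) :
    Nat.card (Quotient t) ≤ Nat.card (Quotient r) := by
  refine Nat.card_le_card_of_surjective (Quotient.map' id fun a b hab => h hab) ?_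
  rintro ⟨x⟩
  exact ⟨Quotient.mk r x, rfl⟩

theorem card_quotient_lt_of_le {r t : Setoid D} (h : r ≤ t) {x y : D} (ht : t x y)
    (hr : ¬ r x y) : Nat.card (Quotient t) + 1 ≤ Nat.card (Quotient r) := by
  by_contra hcon
  have hcard : Nat.card (Quotient t) = Nat.card (Quotient r) :=
    le_antisymm (card_quotient_le_of_le h) (by omega)
  let q : Quotient r → Quotient t := Quotient.map' id fun a b hab => h hab
  have hq : Function.Surjective q := by
    rintro ⟨x⟩
    exact ⟨Quotient.mk r x, rfl⟩
  have := Nat.bijective_iff_surjective_and_card q |>.2 ⟨hq, hcard.symm⟩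
  refine hr (Quotient.exact (this.1 (a₁ := Quotient.mk r x) (a₂ := Quotient.mk r y) ?_))
  exact Quotient.sound ht

/-- Identifying two points merges at most two classes. -/
theorem card_quotient_le_add_one {r t : Setoid D} {x y : D}
    (h : ∀ s : Setoid D, r ≤ s → s x y → t ≤ s) :
    Nat.card (Quotient r) ≤ Nat.card (Quotient t) + 1 := by
  classical
  -- Redirecting the class of `x` to that of `y` identifies the two; the only class of `r` that may
  -- be lost is that of `x`, which `none` supplies below.
  let g : D → Quotient r := fun u => if r u x then Quotient.mk r y else Quotient.mk r u
  have ht : t ≤ Setoid.ker g := by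
    refine h _ (fun a b hab => ?_) ?_
    · change g a = g b
      have : r a x ↔ r b x := ⟨fun h => r.trans (r.symm hab) h, fun h => r.trans hab h⟩
      simp only [g, this]
      split_ifs
      · rfl
      · exact Quotient.sound hab
    · change g x = g y
      simp only [g, r.refl x, if_true]
      split_ifs <;> rfl
  let q : Option (Quotient t) → Quotient r := fun o =>
    o.elim (Quotient.mk r x) (Quotient.lift g fun a b hab => ht hab)
  have hq : Function.Surjective q := by
    rintro ⟨u⟩
    by_cases hu : r u x
    · exact ⟨none, Quotient.sound (r.symm hu)⟩
    · exact ⟨some (Quotient.mk t u), by simp [q, g, hu]; rfl⟩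
  have := Nat.card_le_card_of_surjective q hq
  rwa [Finite.card_option] at this

open Equiv in
/-- Multiplying by a transposition of two points in different orbits joins the orbits. -/
theorem sameCycle_swap_mul_of_not_sameCycle [DecidableEq D] {f : Perm D} {x y : D}
    (h : ¬ f.SameCycle x y) : (swap x y * f).SameCycle x y := by
  have hpos : 0 < Function.minimalPeriod f x :=
    Function.minimalPeriod_pos_of_mem_periodicPts
      (Function.Injective.mem_periodicPts f.injective x)
  set m := Function.minimalPeriod f x with hm
  have key : ∀ k < m, ((swap x y * f) ^ k) x = (f ^ k) x := by
    intro k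
    induction k with
    | zero => intro _; rfl
    | succ k ih =>
      intro hk
      rw [pow_succ', Perm.mul_apply, ih (by omega), Perm.mul_apply, ← Perm.mul_apply f,
        ← pow_succ']
      refine swap_apply_of_ne_of_ne (fun he => ?_) fun he => h ⟨(k + 1 : ℕ), by rwa [zpow_natCast]⟩
      refine Function.not_isPeriodicPt_of_pos_of_lt_minimalPeriod (Nat.succ_ne_zero k) hk ?_
      rwa [Function.IsPeriodicPt, Function.IsFixedPt, Perm.iterate_eq_pow]
  refine ⟨m, ?_⟩
  obtain ⟨k, hk⟩ : ∃ k, m = k + 1 := ⟨m - 1, by omega⟩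
  have hper : (f ^ m) x = x := by
    rw [← Perm.iterate_eq_pow]
    exact Function.iterate_minimalPeriod
  rw [zpow_natCast, hk, pow_succ', Perm.mul_apply, key k (by omega), Perm.mul_apply,
    ← Perm.mul_apply f, ← pow_succ', ← hk, hper, swap_apply_left]

section Detach

open Equiv

variable [DecidableEq D] (f g : Perm D) (x : D)

/-- Taking a dart out of its vertex does not increase the genus. -/
theorem orbitCount_detach :
    orbitCount f + orbitCount (f * g) + 2 * jointOrbitCount (detach f x) g ≤
      orbitCount (detach f x) + orbitCount (detach f x * g) + 2 * jointOrbitCount f g := by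
  by_cases hx : f x = x
  · have : detach f x = f := by rw [detach, hx, swap_self, ← Perm.one_def, one_mul]
    rw [this]
  set f' := detach f x with hf'
  set y := f x with hy
  have hff : swap x y * f' = f := swap_detach f x
  have hxy : f.SameCycle x y := ⟨1, by simp [hy]⟩
  have h1 : orbitCount f + 1 ≤ orbitCount f' := by
    refine card_quotient_lt_of_le (x := x) (y := y) (sameCycle_setoid_le fun z => ?_) hxy ?_
    · exact Setoid.trans' _ (show f.SameCycle z (f z) from ⟨1, by simp⟩) (rel_swap hxy _)
    · intro h
      exact hx (Perm.SameCycle.eq_of_left h (detach_apply_self f x)).symm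
  have hle : ∀ s : Setoid D, jointSetoid f' g ≤ s → s x y → jointSetoid f g ≤ s := by
    intro s hs hsxy
    refine jointSetoid_le (fun z => ?_) fun z => hs (jointSetoid_right f' g z)
    rw [← hff]
    exact s.trans (hs (jointSetoid_left f' g z)) (rel_swap hsxy _)
  have hφ : swap x y * (f' * g) = f * g := by rw [← mul_assoc, hff]
  have hφ' : swap x y * (f * g) = f' * g := by rw [← mul_assoc, hf', detach]
  -- Detaching creates a new vertex orbit in either case. If `x` and `y` share a face afterwards, no
  -- component is split and at most one face is lost. Otherwise a face is split, which pays for the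
  -- possible new component.
  by_cases hr : (f' * g).SameCycle x y
  · have h2 : jointOrbitCount f' g ≤ jointOrbitCount f g := by
      refine card_quotient_le_of_le (hle _ le_rfl ?_)
      refine sameCycle_setoid_le (f := f' * g) (fun z => ?_) hr
      exact Setoid.trans' _ (jointSetoid_right f' g z) (jointSetoid_left f' g _)
    have h3 : orbitCount (f * g) ≤ orbitCount (f' * g) + 1 := by
      refine card_quotient_le_add_one (x := x) (y := y) fun s hs hsxy =>
        sameCycle_setoid_le fun z => ?_
      rw [← hφ']
      exact s.trans (hs (show (f * g).SameCycle z ((f * g) z) from ⟨1, by simp⟩)) (rel_swap hsxy _)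
    omega
  · have h2 : jointOrbitCount f' g ≤ jointOrbitCount f g + 1 :=
      card_quotient_le_add_one hle
    have hr' : (f * g).SameCycle x y := by
      rw [← hφ]; exact sameCycle_swap_mul_of_not_sameCycle hr
    have h3 : orbitCount (f * g) + 1 ≤ orbitCount (f' * g) := by
      refine card_quotient_lt_of_le (sameCycle_setoid_le fun z => ?_) hr' hr
      rw [← hφ']
      exact Setoid.trans' _ (show (f * g).SameCycle z ((f * g) z) from ⟨1, by simp⟩)
        (rel_swap hr' _)
    omega

end Detach

theorem exists_detach_finset (f g : Equiv.Perm D) (T : Finset D) :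
    ∃ f' : Equiv.Perm D,
      (∀ u v, f'.SameCycle u v ↔ u = v ∨ (u ∉ T ∧ v ∉ T ∧ f.SameCycle u v)) ∧
      orbitCount f + orbitCount (f * g) + 2 * jointOrbitCount f' g ≤
        orbitCount f' + orbitCount (f' * g) + 2 * jointOrbitCount f g := by
  classical
  induction T using Finset.induction_on with
  | empty =>
    refine ⟨f, fun u v => ?_, le_rfl⟩
    simp only [Finset.notMem_empty, not_false_eq_true, true_and]
    exact ⟨Or.inr, fun h => h.elim (fun h => h ▸ Equiv.Perm.SameCycle.refl _ _) id⟩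
  | insert x T _ ih =>
    obtain ⟨f', h1, h2⟩ := ih
    refine ⟨detach f' x, fun u v => ?_, ?_⟩
    · rw [sameCycle_detach_iff, h1]
      simp only [Finset.mem_insert, not_or]
      tauto
    · have := orbitCount_detach f' g x
      omega

end Orbits
end PlaneTorus

namespace PlaneTorus

/-! ### Euler's inequality for subgraphs of an embedded graph. -/

section Subgraph

variable {V : Type*} {G : SimpleGraph V}

theorem RotationSystem.rel_of_fst_eq (R : RotationSystem G) {d e : G.Dart} (h : d.fst = e.fst) :
    jointSetoid R.next (dartReversal G) d e :=
  (le_sup_left : Equiv.Perm.SameCycle.setoid R.next ≤ _) ((R.sameCycle_iff d e).2 h)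

theorem RotationSystem.rel_of_walk (R : RotationSystem G) {u v : V} (p : G.Walk u v) :
    ∀ d e : G.Dart, d.fst = u → e.fst = v → jointSetoid R.next (dartReversal G) d e := by
  induction p with
  | nil => intro d e hd he; exact R.rel_of_fst_eq (hd.trans he.symm)
  | @cons u w v h p ih =>
    intro d e hd he
    let d₀ : G.Dart := ⟨(u, w), h⟩
    refine Setoid.trans' _ (R.rel_of_fst_eq (show d.fst = d₀.fst from hd)) ?_
    exact Setoid.trans' _ (jointSetoid_right _ _ d₀) (ih _ _ rfl he)

instance finite_dart [Finite V] : Finite G.Dart :=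
  Finite.of_injective _ SimpleGraph.Dart.toProd_injective

variable {H : SimpleGraph V} (hHG : H ≤ G)

/-- A dart of a subgraph as a dart of the graph. -/
def liftDart (d : H.Dart) : G.Dart := ⟨d.toProd, hHG d.adj⟩

theorem liftDart_injective : Function.Injective (liftDart hHG) := by
  intro d e h
  exact SimpleGraph.Dart.ext d e (Prod.ext (congrArg (fun d : G.Dart => d.fst) h)
    (congrArg (fun d : G.Dart => d.snd) h))

theorem exists_liftDart_eq {d : G.Dart} (hd : H.Adj d.fst d.snd) : ∃ e, liftDart hHG e = d :=
  ⟨⟨d.toProd, hd⟩, rfl⟩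

/-- An injective map that intertwines two permutations respects their orbits. -/
theorem sameCycle_map_iff {D E : Type*} [Finite D] [Finite E] {f : Equiv.Perm D}
    {g : Equiv.Perm E} {i : D → E} (hi : Function.Injective i) (h : ∀ d, i (f d) = g (i d))
    (d e : D) : f.SameCycle d e ↔ g.SameCycle (i d) (i e) := by
  have key : ∀ (n : ℕ) d, i ((f ^ n) d) = (g ^ n) (i d) := by
    intro n
    induction n with
    | zero => intro d; rfl
    | succ n ih => intro d; rw [pow_succ', pow_succ', Equiv.Perm.mul_apply, h, ih]; rfl
  constructor
  · intro hde
    obtain ⟨n, _, hn⟩ := hde.exists_pow_eq'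
    exact ⟨n, by rw [zpow_natCast, ← key, hn]⟩
  · intro hde
    obtain ⟨n, _, hn⟩ := hde.exists_pow_eq'
    exact ⟨n, by rw [zpow_natCast]; exact hi (by rw [key, hn])⟩

variable [Finite V]

theorem RotationSystem.card_le_orbitCount_next (R : RotationSystem G) :
    Nat.card V ≤ orbitCount R.next + Nat.card {v : V // ∀ w, ¬ G.Adj v w} := by
  rw [orbitCount, ← Nat.card_sum]
  refine Nat.card_le_card_of_surjective
    (Sum.elim (Quotient.lift (fun d : G.Dart => d.fst) fun d e h => (R.sameCycle_iff d e).1 h)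
      Subtype.val) fun v => ?_
  by_cases hv : ∀ w, ¬ G.Adj v w
  · exact ⟨Sum.inr ⟨v, hv⟩, rfl⟩
  · push Not at hv
    obtain ⟨w, hw⟩ := hv
    exact ⟨Sum.inl (Quotient.mk _ ⟨(v, w), hw⟩), rfl⟩

theorem RotationSystem.jointOrbitCount_le (R : RotationSystem G) :
    jointOrbitCount R.next (dartReversal G) + Nat.card {v : V // ∀ w, ¬ G.Adj v w} ≤
      Nat.card G.ConnectedComponent := by
  have hle : jointSetoid R.next (dartReversal G) ≤
      Setoid.ker fun d : G.Dart => G.connectedComponentMk d.fst := by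
    refine jointSetoid_le (fun d => ?_) fun d => ?_
    · have : d.fst = (R.next d).fst := ((R.sameCycle_iff d (R.next d)).1 ⟨1, by simp⟩)
      exact congrArg _ this
    · exact SimpleGraph.ConnectedComponent.sound d.adj.reachable
  have hiso : ∀ v : V, (∀ w, ¬ G.Adj v w) → ∀ u, G.Reachable v u → v = u := by
    rintro v hv u ⟨p⟩
    cases p with
    | nil => rfl
    | cons h _ => exact absurd h (hv _)
  rw [jointOrbitCount, ← Nat.card_sum]
  refine Nat.card_le_card_of_injective
    (Sum.elim (Quotient.lift (fun d : G.Dart => G.connectedComponentMk d.fst) fun d e h => hle h)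
      fun v => G.connectedComponentMk v.1) ?_
  rintro (⟨⟨d⟩⟩ | ⟨v, hv⟩) (⟨⟨e⟩⟩ | ⟨w, hw⟩) h
  · obtain ⟨p⟩ := SimpleGraph.ConnectedComponent.exact h
    exact congrArg Sum.inl (Quotient.sound (R.rel_of_walk p d e rfl rfl))
  · have := hiso w hw _ (SimpleGraph.ConnectedComponent.exact h).symm
    exact absurd (this ▸ d.adj) (hw d.snd)
  · have := hiso v hv _ (SimpleGraph.ConnectedComponent.exact h)
    exact absurd (this ▸ e.adj) (hv e.snd)
  · have := hiso v hv _ (SimpleGraph.ConnectedComponent.exact h)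
    subst this
    rfl

/-- An isolated vertex has no dart. It adds one vertex, one region and one component, and 1 + 1 = 2
· 1, so isolated vertices cancel from Euler's formula. -/
theorem RotationSystem.HasGenus.card_edgeSet_le {R : RotationSystem G} {h : ℕ}
    (hR : R.HasGenus h) :
    Nat.card G.edgeSet + 2 * jointOrbitCount R.next (dartReversal G) ≤
      orbitCount R.next + orbitCount (R.next * dartReversal G) + 2 * h := by
  have h1 := R.card_le_orbitCount_next
  have h2 := R.jointOrbitCount_le
  have h3 : R.numRegions = orbitCount (R.next * dartReversal G) +
    Nat.card {v : V // ∀ w, ¬ G.Adj v w} := rfl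
  unfold HasGenus at hR
  omega

theorem card_dart_eq (G : SimpleGraph V) : Nat.card G.Dart = 2 * Nat.card G.edgeSet := by
  classical
  have := Fintype.ofFinite V
  rw [Nat.card_eq_fintype_card, SimpleGraph.dart_card_eq_twice_card_edges,
    SimpleGraph.edgeFinset_card, Nat.card_eq_fintype_card]

/-- The orbit condition makes `f` preserve the darts of `H`, where its orbits are exactly the
vertices. -/
theorem exists_rotationSystem_restrict {f : Equiv.Perm G.Dart}
    (hf : ∀ d e, f.SameCycle d e ↔ d = e ∨
      (H.Adj d.fst d.snd ∧ H.Adj e.fst e.snd ∧ d.fst = e.fst)) :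
    ∃ R : RotationSystem H, ∀ d, liftDart hHG (R.next d) = f (liftDart hHG d) := by
  have hmem : ∀ d : H.Dart, ∃ e : H.Dart, liftDart hHG e = f (liftDart hHG d) := by
    intro d
    rcases (hf (liftDart hHG d) (f (liftDart hHG d))).1 ⟨1, by simp⟩ with h | h
    · exact ⟨d, h⟩
    · exact exists_liftDart_eq hHG h.2.1
  choose n hn using hmem
  have hinj : Function.Injective n := by
    intro d e h
    exact liftDart_injective hHG (f.injective (by rw [← hn, ← hn, h]))
  let p : Equiv.Perm H.Dart := Equiv.ofBijective n (Finite.injective_iff_bijective.1 hinj)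
  have hp : ∀ d, liftDart hHG (p d) = f (liftDart hHG d) := hn
  refine ⟨⟨p, fun d e => ?_⟩, hp⟩
  rw [sameCycle_map_iff (liftDart_injective hHG) hp, hf]
  constructor
  · rintro (h | h)
    · rw [liftDart_injective hHG h]
    · exact h.2.2
  · intro h
    exact Or.inr ⟨d.adj, e.adj, h⟩

/-- Euler's inequality for a subgraph, in the rotation inherited from an embedding. -/
theorem EmbedsInSurface.exists_rotationSystem {g : ℕ} (hG : EmbedsInSurface G g) (hHG : H ≤ G)
    (hne : ∃ u v, H.Adj u v) (W : Finset V) (hW : ∀ u v, H.Adj u v → u ∈ W) :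
    ∃ R : RotationSystem H, Nat.card H.edgeSet + 2 ≤ W.card + orbitCount R.facePerm + 2 * g := by
  classical
  have := Fintype.ofFinite V
  obtain ⟨R, h, hg, hR⟩ := hG
  -- The darts outside `H` are kept as fixed points. Each deleted edge thus becomes a component of
  -- its own with two vertices, one edge and one face, and 2 - 1 + 1 = 2 cancels from Euler's
  -- formula.
  let T : Finset G.Dart := Finset.univ.filter fun d => ¬ H.Adj d.fst d.snd
  obtain ⟨f, hf, hle⟩ := exists_detach_finset R.next (dartReversal G) T
  have hf' : ∀ d e, f.SameCycle d e ↔ d = e ∨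
      (H.Adj d.fst d.snd ∧ H.Adj e.fst e.snd ∧ d.fst = e.fst) := by
    intro d e
    rw [hf, R.sameCycle_iff]
    simp [T]
  obtain ⟨S, hS⟩ := exists_rotationSystem_restrict hHG hf'
  refine ⟨S, ?_⟩
  have hE := hR.card_edgeSet_le
  let N := {e : Sym2 V // e ∈ G.edgeSet ∧ e ∉ H.edgeSet}
  have hN : Nat.card G.edgeSet = Nat.card H.edgeSet + Nat.card N := by
    rw [← Nat.card_sum]
    refine (Nat.card_congr (Equiv.ofBijective (Sum.elim (fun e : H.edgeSet => (⟨e.1,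
      SimpleGraph.edgeSet_mono hHG e.2⟩ : G.edgeSet)) (fun e : N => ⟨e.1, e.2.1⟩)) ⟨?_, ?_⟩)).symm
    · rintro (⟨e, he⟩ | ⟨e, he⟩) (⟨e', he'⟩ | ⟨e', he'⟩) hee <;> simp at hee <;> subst hee
      · rfl
      · exact absurd he he'.2
      · exact absurd he' he.2
      · rfl
    · rintro ⟨e, he⟩
      by_cases h : e ∈ H.edgeSet
      · exact ⟨Sum.inl ⟨e, h⟩, rfl⟩
      · exact ⟨Sum.inr ⟨e, he, h⟩, rfl⟩
  have hT : T.card + Nat.card H.Dart = Nat.card G.Dart := by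
    have h1 : Nat.card H.Dart = (Tᶜ).card := by
      rw [← Nat.card_eq_finsetCard]
      refine Nat.card_congr (Equiv.ofBijective
        (fun d => ⟨liftDart hHG d, by
          simpa [T] using (show H.Adj (liftDart hHG d).fst (liftDart hHG d).snd from d.adj)⟩) ⟨fun d e h => ?_, ?_⟩)
      · exact liftDart_injective hHG (congrArg Subtype.val h)
      · rintro ⟨d, hd⟩
        exact ⟨⟨d.toProd, by simpa [T] using hd⟩, rfl⟩
    rw [h1, Finset.card_add_card_compl, Nat.card_eq_fintype_card]
  have hT' : T.card = 2 * Nat.card N := by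
    have := card_dart_eq G
    have := card_dart_eq H
    omega
  have hloop : ∀ d : G.Dart, ¬ H.Adj d.fst d.snd → f d = d := by
    intro d hd
    rcases (hf' d (f d)).1 ⟨1, by simp⟩ with h | h
    · exact h.symm
    · exact absurd h.1 hd
  have hV : orbitCount f ≤ W.card + T.card := by
    have : W.card + T.card = Nat.card (W ⊕ T) := by simp
    rw [this]
    let q : G.Dart → W ⊕ T := fun d => if h : H.Adj d.fst d.snd then Sum.inl ⟨d.fst, hW _ _ h⟩ else
      Sum.inr ⟨d, by simpa [T] using h⟩
    have hq : ∀ d e, f.SameCycle d e ↔ q d = q e := by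
      intro d e
      rw [hf']
      by_cases hd : H.Adj d.fst d.snd <;> by_cases he : H.Adj e.fst e.snd <;> simp [q, hd, he]
      · rintro rfl; rfl
      · rintro rfl; exact he hd
      · rintro rfl; exact hd he
    refine Nat.card_le_card_of_injective (Quotient.lift q fun d e h => (hq d e).1 h) ?_
    rintro ⟨d⟩ ⟨e⟩ h
    exact Quotient.sound ((hq d e).2 h)
  have hadj : ∀ d : G.Dart, H.Adj d.fst d.snd ↔ H.Adj d.symm.fst d.symm.snd := by
    intro d
    exact H.adj_comm _ _
  have hstep : ∀ d : G.Dart, (H.Adj d.fst d.snd ↔ H.Adj (f d).fst (f d).snd) := by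
    intro d
    rcases (hf' d (f d)).1 ⟨1, by simp⟩ with h | h
    · rw [← h]
    · exact ⟨fun _ => h.2.1, fun _ => h.1⟩
  -- The extra 1 stands for the darts of `H`, which exist by `hne`; it yields the 2 in the
  -- conclusion.
  have hC : Nat.card N + 1 ≤ jointOrbitCount f (dartReversal G) := by
    rw [← Finite.card_option]
    let q : G.Dart → Option N := fun d => if h : H.Adj d.fst d.snd then none else
      some ⟨d.edge, d.edge_mem, h⟩
    have hq : jointSetoid f (dartReversal G) ≤ Setoid.ker q := by
      refine jointSetoid_le (fun d => ?_) fun d => ?_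
      · change q d = q (f d)
        by_cases hd : H.Adj d.fst d.snd
        · have := (hstep d).1 hd
          simp only [q, hd, this, dif_pos]
        · rw [hloop d hd]
      · change q d = q d.symm
        by_cases hd : H.Adj d.fst d.snd
        · have := (hadj d).1 hd
          simp only [q, hd, this, dif_pos]
        · have := fun h => hd ((hadj d).2 h)
          simp only [q]
          rw [dif_neg hd, dif_neg this]
          simp only [SimpleGraph.Dart.edge_symm]
    refine Nat.card_le_card_of_surjective (Quotient.lift q fun d e h => hq h) ?_
    rintro (_ | ⟨⟨u, v⟩, he, he'⟩)
    · obtain ⟨u, v, huv⟩ := hne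
      refine ⟨Quotient.mk _ ⟨(u, v), hHG huv⟩, ?_⟩
      simp [q, huv]
    · refine ⟨Quotient.mk _ ⟨(u, v), he⟩, ?_⟩
      have : ¬ H.Adj u v := he'
      simp [q, this]
      rfl
  have hface : ∀ d, liftDart hHG (S.facePerm d) = (f * dartReversal G) (liftDart hHG d) := by
    intro d
    exact hS d.symm
  have hF : orbitCount (f * dartReversal G) ≤ orbitCount S.facePerm + Nat.card N := by
    have hedge : ∀ e : N, ∃ d : G.Dart, d.edge = e.1 := by
      rintro ⟨⟨u, v⟩, he, he'⟩
      exact ⟨⟨(u, v), he⟩, rfl⟩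
    choose r hr using hedge
    rw [orbitCount, orbitCount, ← Nat.card_sum]
    refine Nat.card_le_card_of_surjective (Sum.elim (Quotient.map' (liftDart hHG) fun d e h =>
      (sameCycle_map_iff (liftDart_injective hHG) hface d e).1 h)
      fun e : N => Quotient.mk _ (r e)) ?_
    rintro ⟨d⟩
    by_cases hd : H.Adj d.fst d.snd
    · exact ⟨Sum.inl (Quotient.mk _ ⟨d.toProd, hd⟩), rfl⟩
    · refine ⟨Sum.inr ⟨d.edge, d.edge_mem, hd⟩, Quotient.sound ?_⟩
      change (f * dartReversal G).SameCycle _ d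
      rcases (SimpleGraph.dart_edge_eq_iff _ _).1 (hr ⟨d.edge, d.edge_mem, hd⟩) with h | h
      · rw [h]
      · rw [h]
        refine Equiv.Perm.SameCycle.symm ⟨1, ?_⟩
        rw [zpow_one]
        exact hloop d.symm fun h => hd ((hadj d).2 h)
  omega

end Subgraph
-- Face lengths and bounds on the number of faces.
theorem mul_orbitCount_le {D : Type*} [Finite D] (f : Equiv.Perm D) (S : Finset D) (k : ℕ)
    (h : ∀ d, ∃ T ⊆ S, k ≤ T.card ∧ ∀ e ∈ T, f.SameCycle d e) :
    k * orbitCount f ≤ S.card := by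
  have : DecidableEq (Quotient (Equiv.Perm.SameCycle.setoid f)) := Classical.decEq _
  have := Fintype.ofFinite D
  have : Fintype (Quotient (Equiv.Perm.SameCycle.setoid f)) := Fintype.ofFinite _
  rw [orbitCount, Nat.card_eq_fintype_card, ← Finset.card_univ]
  refine Finset.mul_card_image_le_card_of_maps_to
    (f := fun d => Quotient.mk (Equiv.Perm.SameCycle.setoid f) d) (fun _ _ => Finset.mem_univ _) k ?_
  intro q _
  obtain ⟨d, rfl⟩ := Quotient.exists_rep q
  obtain ⟨T, hTS, hT, hd⟩ := h d
  refine hT.trans (Finset.card_le_card fun e he => ?_)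
  rw [Finset.mem_filter]
  refine ⟨hTS he, ?_⟩
  exact Quotient.sound (Equiv.Perm.SameCycle.symm (hd e he))

/-- No edge of the graph forms a connected component. -/
def NoIsolatedEdge {V : Type*} (H : SimpleGraph V) : Prop :=
  ∀ u v, H.Adj u v → ∃ w, (w ≠ v ∧ H.Adj u w) ∨ (w ≠ u ∧ H.Adj v w)

namespace RotationSystem

variable {V : Type*} {H : SimpleGraph V} (R : RotationSystem H)

theorem fst_next (d : H.Dart) : (R.next d).fst = d.fst :=
  ((R.sameCycle_iff d (R.next d)).1 ⟨1, by simp⟩).symm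

theorem fst_facePerm (d : H.Dart) : (R.facePerm d).fst = d.snd :=
  R.fst_next d.symm

theorem sameCycle_facePerm (d : H.Dart) : R.facePerm.SameCycle d (R.facePerm d) :=
  ⟨1, by simp⟩

theorem sameCycle_facePerm₂ (d : H.Dart) :
    R.facePerm.SameCycle d (R.facePerm (R.facePerm d)) :=
  (R.sameCycle_facePerm d).trans (R.sameCycle_facePerm _)

theorem sameCycle_facePerm₃ (d : H.Dart) :
    R.facePerm.SameCycle d (R.facePerm (R.facePerm (R.facePerm d))) :=
  (R.sameCycle_facePerm₂ d).trans (R.sameCycle_facePerm _)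

theorem facePerm_ne (d : H.Dart) : R.facePerm d ≠ d := by
  intro h
  have := R.fst_facePerm d
  rw [h] at this
  exact d.fst_ne_snd this

/-- A dart that the rotation fixes is the only one at its initial vertex. -/
theorem eq_of_next_eq {d : H.Dart} (h : R.next d = d) {w : V} (hw : H.Adj d.fst w) :
    w = d.snd := by
  have : R.next.SameCycle d ⟨(d.fst, w), hw⟩ := (R.sameCycle_iff _ _).2 rfl
  have := this.eq_of_left h
  rw [this]

theorem eq_of_facePerm_eq_symm {d : H.Dart} (h : R.facePerm d = d.symm) {w : V}
    (hw : H.Adj d.snd w) : w = d.fst :=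
  R.eq_of_next_eq (d := d.symm) h hw

/-- A face of length two consists of a dart and its reverse, both fixed by the rotation; then both
ends have degree one. -/
theorem facePerm_facePerm_ne (hH : NoIsolatedEdge H) (d : H.Dart) :
    R.facePerm (R.facePerm d) ≠ d := by
  intro h
  have h1 : R.facePerm d = d.symm := by
    refine SimpleGraph.Dart.ext _ _ (Prod.ext (R.fst_facePerm d) ?_)
    have := R.fst_facePerm (R.facePerm d)
    rw [h] at this
    exact this.symm
  obtain ⟨w, ⟨hw, ha⟩ | ⟨hw, ha⟩⟩ := hH _ _ d.adj
  · refine hw (R.eq_of_facePerm_eq_symm (d := d.symm) ?_ ha)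
    rw [← h1, h, h1, d.symm_symm]
  · exact hw (R.eq_of_facePerm_eq_symm h1 ha)

theorem exists_three_of_noIsolatedEdge [DecidableEq V] (hH : NoIsolatedEdge H) (d : H.Dart) :
    ({d, R.facePerm d, R.facePerm (R.facePerm d)} : Finset H.Dart).card = 3 := by
  refine Finset.card_eq_three.2 ⟨_, _, _, (R.facePerm_ne d).symm,
    (R.facePerm_facePerm_ne hH d).symm, (R.facePerm_ne _).symm, rfl⟩

variable [Finite V]

theorem three_mul_orbitCount_facePerm_le (hH : NoIsolatedEdge H) :
    3 * orbitCount R.facePerm ≤ Nat.card H.Dart := by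
  classical
  have := Fintype.ofFinite H.Dart
  rw [Nat.card_eq_fintype_card, ← Finset.card_univ]
  refine mul_orbitCount_le _ _ _ fun d =>
    ⟨_, Finset.subset_univ _, (R.exists_three_of_noIsolatedEdge hH d).ge, fun e he => ?_⟩
  simp only [Finset.mem_insert, Finset.mem_singleton] at he
  rcases he with rfl | rfl | rfl
  · rfl
  · exact R.sameCycle_facePerm _
  · exact R.sameCycle_facePerm₂ _

/-- If the number of faces is as large as possible, then all faces are triangles. -/
theorem facePerm_pow_three (hH : NoIsolatedEdge H)
    (hF : Nat.card H.Dart ≤ 3 * orbitCount R.facePerm) (d : H.Dart) :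
    R.facePerm (R.facePerm (R.facePerm d)) = d := by
  classical
  have := Fintype.ofFinite H.Dart
  by_contra hd
  set φ := R.facePerm with hφ
  set z := φ (φ (φ d)) with hz
  -- If `z ≠ d`, the face of `d` has a fourth dart `z`, so every face keeps three darts after `z` is
  -- discarded, one dart too few for `hF`.
  have key : 3 * orbitCount φ ≤ (Finset.univ.erase z).card := by
    refine mul_orbitCount_le _ _ _ fun e => ?_
    have h3 := R.exists_three_of_noIsolatedEdge hH
    by_cases he : φ.SameCycle d e
    · refine ⟨{d, φ d, φ (φ d)}, ?_, (h3 d).ge, fun x hx => ?_⟩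
      · intro x hx
        simp only [Finset.mem_insert, Finset.mem_singleton] at hx
        refine Finset.mem_erase.2 ⟨?_, Finset.mem_univ _⟩
        rcases hx with rfl | rfl | rfl
        · exact Ne.symm hd
        · exact (R.facePerm_facePerm_ne hH _).symm
        · exact (R.facePerm_ne _).symm
      · simp only [Finset.mem_insert, Finset.mem_singleton] at hx
        refine he.symm.trans ?_
        rcases hx with rfl | rfl | rfl
        · rfl
        · exact R.sameCycle_facePerm _
        · exact R.sameCycle_facePerm₂ _
    · refine ⟨{e, φ e, φ (φ e)}, ?_, (h3 e).ge, fun x hx => ?_⟩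
      · intro x hx
        simp only [Finset.mem_insert, Finset.mem_singleton] at hx
        refine Finset.mem_erase.2 ⟨fun hxz => he ?_, Finset.mem_univ _⟩
        refine (R.sameCycle_facePerm₃ d).trans (show φ.SameCycle z e from ?_)
        rw [← hxz]
        rcases hx with rfl | rfl | rfl
        · rfl
        · exact (R.sameCycle_facePerm _).symm
        · exact (R.sameCycle_facePerm₂ _).symm
      · simp only [Finset.mem_insert, Finset.mem_singleton] at hx
        rcases hx with rfl | rfl | rfl
        · rfl
        · exact R.sameCycle_facePerm _
        · exact R.sameCycle_facePerm₂ _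
  rw [Finset.card_erase_of_mem (Finset.mem_univ _), Finset.card_univ,
    ← Nat.card_eq_fintype_card] at key
  have : 0 < Nat.card H.Dart := Nat.card_pos_iff.2 ⟨⟨d⟩, inferInstance⟩
  omega

/-- A face walk alternates between `X` and its complement, so length three is impossible. -/
theorem four_mul_orbitCount_facePerm_le (hH : NoIsolatedEdge H) {X : Set V}
    (hX : ∀ u v, H.Adj u v → (u ∈ X ↔ v ∉ X)) :
    4 * orbitCount R.facePerm ≤ Nat.card H.Dart := by
  classical
  have := Fintype.ofFinite H.Dart
  rw [Nat.card_eq_fintype_card, ← Finset.card_univ]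
  set φ := R.facePerm with hφ
  have h3 : ∀ d, φ (φ (φ d)) ≠ d := by
    intro d h
    have h0 := hX _ _ d.adj
    have h1 := hX _ _ (φ d).adj
    have h2 := hX _ _ (φ (φ d)).adj
    rw [R.fst_facePerm] at h1 h2
    have h4 := R.fst_facePerm (φ (φ d))
    rw [← hφ, h] at h4
    rw [← h4] at h2
    tauto
  refine mul_orbitCount_le _ _ _ fun d =>
    ⟨{d, φ d, φ (φ d), φ (φ (φ d))}, Finset.subset_univ _, ?_, fun e he => ?_⟩
  · rw [Finset.card_insert_of_notMem, R.exists_three_of_noIsolatedEdge hH]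
    simp only [Finset.mem_insert, Finset.mem_singleton, not_or]
    exact ⟨(R.facePerm_ne d).symm, (R.facePerm_facePerm_ne hH d).symm, (h3 d).symm⟩
  · simp only [Finset.mem_insert, Finset.mem_singleton] at he
    rcases he with rfl | rfl | rfl | rfl
    · rfl
    · exact R.sameCycle_facePerm _
    · exact R.sameCycle_facePerm₂ _
    · exact R.sameCycle_facePerm₃ _

/-- A bound on the number of faces by the number of darts that do not enter `c`, for a vertex `c`
all of whose neighbours lie in an independent set. -/
theorem three_mul_orbitCount_facePerm_le_of_indep (hH : NoIsolatedEdge H) {c : V} {B : Set V}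
    (hc : ∀ v, H.Adj c v → v ∈ B) (hcB : c ∉ B) (hB : ∀ u ∈ B, ∀ v ∈ B, ¬ H.Adj u v)
    (hdeg : ∀ v, H.Adj v c → ∃ w, w ≠ c ∧ H.Adj v w) :
    3 * orbitCount R.facePerm ≤ Nat.card {d : H.Dart // d.snd ≠ c} := by
  classical
  have := Fintype.ofFinite H.Dart
  rw [Nat.card_eq_fintype_card, Fintype.card_subtype]
  have h3 := R.exists_three_of_noIsolatedEdge hH
  set φ := R.facePerm with hφ
  -- After entering `c` the face goes to `B`, then out of `B` to a vertex other than `c` by `hdeg`.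
  -- That vertex is not adjacent to `c`, so the third step does not enter `c` either.
  have key : ∀ d : H.Dart, d.snd = c → ∃ T ⊆ Finset.univ.filter fun d : H.Dart => d.snd ≠ c,
      3 ≤ T.card ∧ ∀ e ∈ T, φ.SameCycle d e := by
    intro d hd
    have f1 : (φ d).fst = c := (R.fst_facePerm d).trans hd
    have f2 : (φ (φ d)).fst = (φ d).snd := R.fst_facePerm _
    have f3 : (φ (φ (φ d))).fst = (φ (φ d)).snd := R.fst_facePerm _
    have m1 : (φ d).snd ∈ B := hc _ (f1 ▸ (φ d).adj)
    have n1 : (φ d).snd ≠ c := fun h => hcB (h ▸ m1)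
    have m2 : (φ (φ d)).snd ∉ B := fun h => hB _ m1 _ h (f2 ▸ (φ (φ d)).adj)
    have n2 : (φ (φ d)).snd ≠ c := by
      intro h
      have : φ (φ d) = (φ d).symm :=
        SimpleGraph.Dart.ext _ _ (Prod.ext f2 (h.trans f1.symm))
      obtain ⟨w, hw, ha⟩ := hdeg _ (f1 ▸ (φ d).adj.symm)
      exact hw ((R.eq_of_facePerm_eq_symm this ha).trans f1)
    have n3 : (φ (φ (φ d))).snd ≠ c := by
      intro h
      have ha := (φ (φ (φ d))).adj
      rw [f3] at ha
      exact m2 (hc _ (by rw [← h]; exact ha.symm))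
    refine ⟨{φ d, φ (φ d), φ (φ (φ d))}, fun e he => ?_, (h3 _).ge, fun e he => ?_⟩ <;>
    simp only [Finset.mem_insert, Finset.mem_singleton] at he
    · refine Finset.mem_filter.2 ⟨Finset.mem_univ _, ?_⟩
      rcases he with rfl | rfl | rfl <;> assumption
    · rcases he with rfl | rfl | rfl
      · exact R.sameCycle_facePerm _
      · exact R.sameCycle_facePerm₂ _
      · exact R.sameCycle_facePerm₃ _
  refine mul_orbitCount_le _ _ _ fun d => ?_
  by_cases hd : ∃ e, φ.SameCycle d e ∧ e.snd = c
  · obtain ⟨e, hde, he⟩ := hd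
    obtain ⟨T, hT, hT', h⟩ := key e he
    exact ⟨T, hT, hT', fun x hx => hde.trans (h x hx)⟩
  · push Not at hd
    refine ⟨{d, φ d, φ (φ d)}, fun e he => ?_, (h3 d).ge, fun e he => ?_⟩ <;>
    simp only [Finset.mem_insert, Finset.mem_singleton] at he
    · refine Finset.mem_filter.2 ⟨Finset.mem_univ _, hd _ ?_⟩
      rcases he with rfl | rfl | rfl
      · rfl
      · exact R.sameCycle_facePerm _
      · exact R.sameCycle_facePerm₂ _
    · rcases he with rfl | rfl | rfl
      · rfl
      · exact R.sameCycle_facePerm _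
      · exact R.sameCycle_facePerm₂ _

end RotationSystem
end PlaneTorus

namespace PlaneTorus

/-! ### Degrees into vertex sets. -/

variable {V : Type*} {G : SimpleGraph V}

open Classical in
/-- The neighbours of `v` in `X`. -/
noncomputable def nbrIn (G : SimpleGraph V) (v : V) (X : Finset V) : Finset V :=
  X.filter fun w => G.Adj v w

@[simp]
theorem mem_nbrIn {v w : V} {X : Finset V} : w ∈ nbrIn G v X ↔ w ∈ X ∧ G.Adj v w := by
  simp [nbrIn]

/-- The number of neighbours of `v` in `X`. -/
noncomputable def degIn (G : SimpleGraph V) (v : V) (X : Finset V) : ℕ :=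
  (nbrIn G v X).card

theorem degIn_le_card (v : V) (X : Finset V) : degIn G v X ≤ X.card :=
  Finset.card_le_card fun _ h => (mem_nbrIn.1 h).1

theorem exists_adj_of_degIn_pos {v : V} {X : Finset V} (h : 0 < degIn G v X) :
    ∃ w ∈ X, G.Adj v w := by
  obtain ⟨w, hw⟩ := Finset.card_pos.1 h
  exact ⟨w, mem_nbrIn.1 hw⟩

theorem degIn_union [DecidableEq V] {X Y : Finset V} (h : Disjoint X Y) (v : V) :
    degIn G v (X ∪ Y) = degIn G v X + degIn G v Y := by
  classical
  have : nbrIn G v (X ∪ Y) = nbrIn G v X ∪ nbrIn G v Y := by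
    ext w
    simp only [mem_nbrIn, Finset.mem_union, or_and_right]
  rw [degIn, this, Finset.card_union_of_disjoint]
  · rfl
  · refine Finset.disjoint_left.2 fun w hx hy => ?_
    exact Finset.disjoint_left.1 h (mem_nbrIn.1 hx).1 (mem_nbrIn.1 hy).1

theorem degIn_eq_card {v : V} {X : Finset V} (h : ∀ w ∈ X, G.Adj v w) :
    degIn G v X = X.card := by
  rw [degIn]
  congr 1
  ext w
  simpa using h w

theorem degIn_eq_zero {v : V} {X : Finset V} (h : ∀ w ∈ X, ¬ G.Adj v w) :
    degIn G v X = 0 := by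
  rw [degIn, Finset.card_eq_zero]
  refine Finset.eq_empty_of_forall_notMem fun w hw => ?_
  exact h w (mem_nbrIn.1 hw).1 (mem_nbrIn.1 hw).2

theorem sum_degIn_comm (X Y : Finset V) :
    ∑ x ∈ X, degIn G x Y = ∑ y ∈ Y, degIn G y X := by
  classical
  simp only [degIn, nbrIn, Finset.card_filter]
  rw [Finset.sum_comm]
  simp only [G.adj_comm]

theorem degIn_add_degIn_compl_of_notMem {v : V} {X : Finset V} (h : v ∉ X) :
    degIn G v X + degIn Gᶜ v X = X.card := by
  classical
  rw [← Finset.card_filter_add_card_filter_not (s := X) (fun w => G.Adj v w)]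
  have h1 : degIn G v X = (X.filter fun w => G.Adj v w).card := by
    simp only [degIn, nbrIn]
  rw [h1, degIn]
  congr 2
  ext w
  rw [mem_nbrIn, Finset.mem_filter, SimpleGraph.compl_adj]
  exact ⟨fun hw => ⟨hw.1, hw.2.2⟩, fun hw => ⟨hw.1, fun hvw => h (hvw ▸ hw.1), hw.2⟩⟩

theorem degIn_add_degIn_compl_of_mem {v : V} {X : Finset V} (h : v ∈ X) :
    degIn G v X + degIn Gᶜ v X + 1 = X.card := by
  classical
  have herase : ∀ K : SimpleGraph V, degIn K v X = degIn K v (X.erase v) := by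
    intro K
    rw [degIn, degIn]
    congr 1
    ext w
    simp only [mem_nbrIn, Finset.mem_erase]
    exact ⟨fun hw => ⟨⟨hw.2.ne', hw.1⟩, hw.2⟩, fun hw => ⟨hw.1.2, hw.2⟩⟩
  rw [herase G, herase Gᶜ, degIn_add_degIn_compl_of_notMem (Finset.notMem_erase v X),
    Finset.card_erase_add_one h]

theorem card_dart_eq_sum_degIn [Finite V] (H : SimpleGraph V) (W : Finset V)
    (hW : ∀ u v, H.Adj u v → u ∈ W) : Nat.card H.Dart = ∑ v ∈ W, degIn H v W := by
  classical
  have := Fintype.ofFinite V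
  rw [Nat.card_eq_fintype_card, SimpleGraph.dart_card_eq_sum_degrees]
  rw [← Finset.sum_subset (Finset.subset_univ W)]
  · refine Finset.sum_congr rfl fun v _ => ?_
    rw [degIn, ← SimpleGraph.card_neighborFinset_eq_degree]
    congr 1
    ext w
    simp only [SimpleGraph.mem_neighborFinset, mem_nbrIn]
    exact ⟨fun h => ⟨hW _ _ h.symm, h⟩, fun h => h.2⟩
  · intro v _ hv
    rw [← SimpleGraph.card_neighborFinset_eq_degree, Finset.card_eq_zero]
    refine Finset.eq_empty_of_forall_notMem fun w hw => hv (hW v w ?_)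
    simpa using hw

/-! ### Edge bounds for graphs on a surface. -/

variable [Finite V] {g : ℕ}

theorem EmbedsInSurface.card_dart_le (hG : EmbedsInSurface G g) {H : SimpleGraph V} (hHG : H ≤ G)
    (hH : NoIsolatedEdge H) (hne : ∃ u v, H.Adj u v) (W : Finset V)
    (hW : ∀ u v, H.Adj u v → u ∈ W) : Nat.card H.Dart + 12 ≤ 6 * W.card + 12 * g := by
  obtain ⟨R, hR⟩ := hG.exists_rotationSystem hHG hne W hW
  have := R.three_mul_orbitCount_facePerm_le hH
  have := card_dart_eq H
  omega

/-- At most `3 |W| - 6 + 6 g` edges join vertices of `W`. -/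
theorem EmbedsInSurface.sum_degIn_le (hG : EmbedsInSurface G g) (W : Finset V)
    (hW : ∃ u ∈ W, ∃ v ∈ W, ∃ w ∈ W, v ≠ w ∧ G.Adj u v ∧ G.Adj u w) :
    ∑ v ∈ W, degIn G v W + 12 ≤ 6 * W.card + 12 * g := by
  classical
  let P : V → V → Prop := fun u v => G.Adj u v ∧ u ∈ W ∧ v ∈ W
  -- The face count needs a graph without isolated edges, so these are removed from the graph
  -- induced on `W`.
  let H : SimpleGraph V :=
    { Adj := fun u v => P u v ∧ ∃ w, (w ≠ v ∧ P u w) ∨ (w ≠ u ∧ P v w)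
      symm := ⟨fun u v ⟨⟨h1, h2, h3⟩, w, hw⟩ => ⟨⟨h1.symm, h3, h2⟩, w, hw.symm⟩⟩
      loopless := ⟨fun u h => G.loopless.irrefl u h.1.1⟩ }
  have hHG : H ≤ G := fun u v h => h.1.1
  have hH : NoIsolatedEdge H := by
    rintro u v ⟨huv, w, ⟨hw, ha⟩ | ⟨hw, ha⟩⟩
    · exact ⟨w, Or.inl ⟨hw, ha, v, Or.inl ⟨hw.symm, huv⟩⟩⟩
    · exact ⟨w, Or.inr ⟨hw, ha, u, Or.inl ⟨hw.symm, huv.1.symm, huv.2.2, huv.2.1⟩⟩⟩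
  have hne : ∃ u v, H.Adj u v := by
    obtain ⟨u, hu, v, hv, w, hw, hvw, h1, h2⟩ := hW
    exact ⟨u, v, ⟨h1, hu, hv⟩, w, Or.inl ⟨hvw.symm, h2, hu, hw⟩⟩
  -- The vertices left out are the ends of isolated edges. Each has degree one in `W`, well within
  -- its share of 6 in the bound.
  let W' := W.filter fun v => ∀ u, P v u → H.Adj v u
  have hW' : ∀ u v, H.Adj u v → u ∈ W' := by
    rintro u v ⟨huv, w, hw⟩
    refine Finset.mem_filter.2 ⟨huv.2.1, fun x hux => ⟨hux, ?_⟩⟩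
    by_contra hcon
    push Not at hcon
    have hv : v = x := by
      by_contra hvx
      exact (hcon v).1 hvx huv
    subst hv
    rcases hw with hw | hw
    · exact (hcon w).1 hw.1 hw.2
    · exact (hcon w).2 hw.1 hw.2
  have hbound := hG.card_dart_le hHG hH hne W' hW'
  rw [card_dart_eq_sum_degIn H W' hW'] at hbound
  have h1 : ∀ v ∈ W', degIn G v W ≤ degIn H v W' := by
    intro v hv
    refine Finset.card_le_card fun w hw => ?_
    rw [mem_nbrIn] at hw ⊢
    have := (Finset.mem_filter.1 hv).2 w ⟨hw.2, (Finset.mem_filter.1 hv).1, hw.1⟩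
    exact ⟨hW' _ _ this.symm, this⟩
  have h2 : ∀ v ∈ W \ W', degIn G v W ≤ 1 := by
    intro v hv
    obtain ⟨hvW, hv'⟩ := Finset.mem_sdiff.1 hv
    have hex : ∃ u, P v u ∧ ¬ H.Adj v u := by
      by_contra hcon
      push Not at hcon
      exact hv' (Finset.mem_filter.2 ⟨hvW, hcon⟩)
    obtain ⟨u, hu, hnu⟩ := hex
    refine Finset.card_le_one.2 fun x hx y hy => ?_
    have hall : ∀ x ∈ nbrIn G v W, x = u := by
      intro x hx
      by_contra hxu
      rw [mem_nbrIn] at hx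
      exact hnu ⟨hu, x, Or.inl ⟨hxu, hx.2, hvW, hx.1⟩⟩
    rw [hall x hx, hall y hy]
  have hsub : W' ⊆ W := Finset.filter_subset _ W
  have h3 := Finset.sum_sdiff (f := fun v => degIn G v W) hsub
  have h4 := Finset.sum_le_sum h1
  have h5 := Finset.sum_le_card_nsmul _ _ _ h2
  have h6 := Finset.card_sdiff_add_card_eq_card hsub
  simp only [smul_eq_mul, mul_one] at h5
  omega

/-- At most `2 (|X| + |Y|) - 4 + 4 g` edges join two disjoint sets. -/
theorem EmbedsInSurface.sum_degIn_le_of_disjoint (hG : EmbedsInSurface G g) {X Y : Finset V}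
    (hXY : Disjoint X Y) (hY : ∀ y ∈ Y, 2 ≤ degIn G y X) (hne : Y.Nonempty) :
    ∑ y ∈ Y, degIn G y X + 4 ≤ 2 * (X.card + Y.card) + 4 * g := by
  classical
  let H : SimpleGraph V :=
    { Adj := fun u v => G.Adj u v ∧ ((u ∈ X ∧ v ∈ Y) ∨ (v ∈ X ∧ u ∈ Y))
      symm := ⟨fun u v h => ⟨h.1.symm, h.2.symm⟩⟩
      loopless := ⟨fun u h => G.loopless.irrefl u h.1⟩ }
  have hHG : H ≤ G := fun u v h => h.1
  have hY2 : ∀ y ∈ Y, ∀ x, ∃ w, w ≠ x ∧ H.Adj y w := by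
    intro y hy x
    obtain ⟨w, hw, hwx⟩ := Finset.exists_mem_ne (hY y hy) x
    rw [mem_nbrIn] at hw
    exact ⟨w, hwx, hw.2, Or.inr ⟨hw.1, hy⟩⟩
  have hH : NoIsolatedEdge H := by
    rintro u v ⟨huv, ⟨-, hv⟩ | ⟨-, hu⟩⟩
    · obtain ⟨w, hw⟩ := hY2 v hv u
      exact ⟨w, Or.inr hw⟩
    · obtain ⟨w, hw⟩ := hY2 u hu v
      exact ⟨w, Or.inl hw⟩
  have hne' : ∃ u v, H.Adj u v := by
    obtain ⟨y, hy⟩ := hne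
    obtain ⟨w, -, hw⟩ := hY2 y hy y
    exact ⟨y, w, hw⟩
  have hW : ∀ u v, H.Adj u v → u ∈ X ∪ Y := by
    rintro u v ⟨-, ⟨h, -⟩ | ⟨-, h⟩⟩
    · exact Finset.mem_union_left _ h
    · exact Finset.mem_union_right _ h
  have hdis : ∀ v, v ∈ X → v ∈ Y → False := fun v hx hy => Finset.disjoint_left.1 hXY hx hy
  obtain ⟨R, hR⟩ := hG.exists_rotationSystem hHG hne' _ hW
  have hF := R.four_mul_orbitCount_facePerm_le hH (X := X) (by
    rintro u v ⟨-, ⟨h, h'⟩ | ⟨h, h'⟩⟩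
    · exact ⟨fun _ hv => hdis v hv h', fun _ => h⟩
    · exact ⟨fun hu => (hdis u hu h').elim, fun hv => (hv h).elim⟩)
  have hcard := card_dart_eq H
  have hsum := card_dart_eq_sum_degIn H _ hW
  rw [Finset.sum_union hXY] at hsum
  have h1 : ∀ x ∈ X, degIn H x (X ∪ Y) = degIn G x Y := by
    intro x hx
    rw [degIn, degIn]
    congr 1
    ext w
    simp only [mem_nbrIn, Finset.mem_union]
    constructor
    · rintro ⟨-, ha, ⟨-, h⟩ | ⟨-, h⟩⟩
      · exact ⟨h, ha⟩
      · exact (hdis x hx h).elim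
    · rintro ⟨h, ha⟩
      exact ⟨Or.inr h, ha, Or.inl ⟨hx, h⟩⟩
  have h2 : ∀ y ∈ Y, degIn H y (X ∪ Y) = degIn G y X := by
    intro x hx
    rw [degIn, degIn]
    congr 1
    ext w
    simp only [mem_nbrIn, Finset.mem_union]
    constructor
    · rintro ⟨-, ha, ⟨h, -⟩ | ⟨h, -⟩⟩
      · exact (hdis x h hx).elim
      · exact ⟨h, ha⟩
    · rintro ⟨h, ha⟩
      exact ⟨Or.inl h, ha, Or.inr ⟨h, hx⟩⟩
  rw [Finset.sum_congr rfl h1, Finset.sum_congr rfl h2, sum_degIn_comm] at hsum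
  rw [Finset.card_union_of_disjoint hXY] at hR
  omega

/-- A graph with as many edges as possible for its surface has a triangular embedding. -/
theorem EmbedsInSurface.exists_triangular (hG : EmbedsInSurface G g) (hH : NoIsolatedEdge G)
    (hne : ∃ u v, G.Adj u v) (hcard : 6 * Nat.card V + 12 * g ≤ Nat.card G.Dart + 12) :
    ∃ R : RotationSystem G, ∀ d, R.facePerm (R.facePerm (R.facePerm d)) = d := by
  have := Fintype.ofFinite V
  obtain ⟨R, hR⟩ := hG.exists_rotationSystem le_rfl hne Finset.univ fun _ _ _ => Finset.mem_univ _
  refine ⟨R, R.facePerm_pow_three hH ?_⟩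
  have := card_dart_eq G
  rw [Finset.card_univ, ← Nat.card_eq_fintype_card] at hR
  omega

/-- If the independent set `B` is completely joined to `C`, then every vertex `c` of `C` has many
neighbours in `C`, provided that there are many edges in all. -/
theorem EmbedsInSurface.le_degIn_of_indep (hG : EmbedsInSurface G g) {B C : Finset V}
    (hBC : Disjoint B C) (hB2 : 2 ≤ B.card) (hC2 : 2 ≤ C.card)
    (hB : ∀ u ∈ B, ∀ v ∈ B, ¬ G.Adj u v) (hjoin : ∀ b ∈ B, ∀ c ∈ C, G.Adj b c)
    {c : V} (hc : c ∈ C) :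
    2 * B.card * C.card + ∑ v ∈ C, degIn G v C + 12 + 2 * B.card ≤
      6 * (B.card + C.card) + 12 * g + 2 * degIn G c C := by
  classical
  have hdis : ∀ v, v ∈ B → v ∈ C → False := fun v hx hy => Finset.disjoint_left.1 hBC hx hy
  -- The edges from `c` into `C` are removed, so that all neighbours of `c` lie in the independent
  -- set `B`. Then the `B.card` darts entering `c` are not needed in the face count, which improves
  -- the usual bound by `2 * B.card`.
  let H : SimpleGraph V :=
    { Adj := fun u v => G.Adj u v ∧
        ((u ∈ B ∧ v ∈ C) ∨ (v ∈ B ∧ u ∈ C) ∨ (u ∈ C ∧ v ∈ C ∧ u ≠ c ∧ v ≠ c))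
      symm := ⟨fun u v h => ⟨h.1.symm, by tauto⟩⟩
      loopless := ⟨fun u h => G.loopless.irrefl u h.1⟩ }
  have hHG : H ≤ G := fun u v h => h.1
  have hBdeg : ∀ b ∈ B, ∀ x, ∃ w, w ≠ x ∧ H.Adj b w := by
    intro b hb x
    obtain ⟨w, hw, hwx⟩ := Finset.exists_mem_ne hC2 x
    exact ⟨w, hwx, hjoin b hb w hw, Or.inl ⟨hb, hw⟩⟩
  have hCdeg : ∀ y ∈ C, ∀ x, ∃ w, w ≠ x ∧ H.Adj y w := by
    intro b hb x
    obtain ⟨w, hw, hwx⟩ := Finset.exists_mem_ne hB2 x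
    exact ⟨w, hwx, (hjoin w hw b hb).symm, Or.inr (Or.inl ⟨hw, hb⟩)⟩
  have hW : ∀ u v, H.Adj u v → u ∈ B ∪ C := by
    rintro u v ⟨-, ⟨h, -⟩ | ⟨-, h⟩ | ⟨h, -⟩⟩
    · exact Finset.mem_union_left _ h
    · exact Finset.mem_union_right _ h
    · exact Finset.mem_union_right _ h
  have hdeg : ∀ u v, H.Adj u v → ∀ x, ∃ w, w ≠ x ∧ H.Adj u w := by
    intro u v h
    rcases Finset.mem_union.1 (hW u v h) with hu | hu
    · exact hBdeg u hu
    · exact hCdeg u hu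
  have hH : NoIsolatedEdge H := by
    intro u v h
    obtain ⟨w, hw⟩ := hdeg u v h v
    exact ⟨w, Or.inl hw⟩
  have hne : ∃ u v, H.Adj u v := by
    obtain ⟨w, -, hw⟩ := hCdeg c hc c
    exact ⟨c, w, hw⟩
  obtain ⟨R, hR⟩ := hG.exists_rotationSystem hHG hne _ hW
  have hF := R.three_mul_orbitCount_facePerm_le_of_indep hH (c := c) (B := B) (by
      rintro v ⟨-, ⟨h, -⟩ | ⟨h, -⟩ | h⟩
      · exact (hdis c h hc).elim
      · exact h
      · exact absurd rfl h.2.2.1) (fun h => hdis c h hc) (fun u hu v hv h => hB u hu v hv h.1)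
    (fun v hv => hdeg v c hv c)
  have hcard := card_dart_eq H
  have hsum := card_dart_eq_sum_degIn H _ hW
  have hBsum : ∀ b ∈ B, degIn H b (B ∪ C) = C.card := by
    intro b hb
    rw [degIn_union hBC, degIn_eq_zero (G := H) (X := B) fun w hw h => hB b hb w hw h.1,
      degIn_eq_card (G := H) (X := C) fun w hw => ⟨hjoin b hb w hw, Or.inl ⟨hb, hw⟩⟩, zero_add]
  have hcB : degIn H c B = B.card :=
    degIn_eq_card fun w hw => ⟨(hjoin w hw c hc).symm, Or.inr (Or.inl ⟨hw, hc⟩)⟩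
  have hcC : degIn H c C = 0 := degIn_eq_zero (by
    rintro v hv ⟨-, ⟨h, -⟩ | ⟨h, -⟩ | h⟩
    · exact (hdis c h hc).elim
    · exact (hdis v h hv).elim
    · exact absurd rfl h.2.2.1)
  have hcsum : ∀ v ∈ C, degIn H v (B ∪ C) = B.card + degIn H v C := by
    intro v hv
    rw [degIn_union hBC,
      degIn_eq_card (G := H) (X := B) fun w hw => ⟨(hjoin w hw v hv).symm, Or.inr (Or.inl ⟨hw, hv⟩)⟩]
  have hsplit : ∀ v ∈ C.erase c, degIn H v C + (if G.Adj c v then 1 else 0) = degIn G v C := by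
    intro v hv
    obtain ⟨hvc, hvC⟩ := Finset.mem_erase.1 hv
    have h1 : degIn H v C = degIn G v (C.erase c) := by
      rw [degIn, degIn]
      congr 1
      ext w
      simp only [mem_nbrIn, Finset.mem_erase]
      constructor
      · rintro ⟨hw, ha, ⟨h, -⟩ | ⟨h, -⟩ | h⟩
        · exact (hdis v h hvC).elim
        · exact (hdis w h hw).elim
        · exact ⟨⟨h.2.2.2, hw⟩, ha⟩
      · rintro ⟨⟨hwc, hw⟩, ha⟩
        exact ⟨hw, ha, Or.inr (Or.inr ⟨hvC, hw, hvc, hwc⟩)⟩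
    have h2 : degIn G v {c} = if G.Adj c v then 1 else 0 := by
      rw [degIn, nbrIn, Finset.filter_singleton, G.adj_comm]
      split_ifs <;> simp
    rw [h1, ← h2, ← degIn_union (by simp)]
    congr 1
    rw [Finset.union_comm, ← Finset.insert_eq, Finset.insert_erase hc]
  have hsplit' : ∑ v ∈ C, degIn H v C + 2 * degIn G c C = ∑ v ∈ C, degIn G v C := by
    rw [← Finset.add_sum_erase _ _ hc, ← Finset.add_sum_erase _ _ hc, hcC,
      ← Finset.sum_congr rfl hsplit, Finset.sum_add_distrib, ← Finset.card_filter]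
    have : degIn G c C = ((C.erase c).filter fun v => G.Adj c v).card := by
      rw [degIn]
      congr 1
      ext w
      simp only [mem_nbrIn, Finset.mem_filter, Finset.mem_erase]
      exact ⟨fun h => ⟨⟨h.2.ne', h.1⟩, h.2⟩, fun h => ⟨h.1.2, h.2⟩⟩
    rw [this]
    ring
  rw [Finset.sum_union hBC, Finset.sum_congr rfl hBsum, Finset.sum_congr rfl hcsum,
    Finset.sum_add_distrib, Finset.sum_const, Finset.sum_const, smul_eq_mul, smul_eq_mul] at hsum
  have hout : Nat.card {d : H.Dart // d.snd ≠ c} + B.card = Nat.card H.Dart := by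
    have hB' : B.card = Nat.card {d : H.Dart // ¬ d.snd ≠ c} := by
      rw [← Nat.card_eq_finsetCard]
      refine Nat.card_congr (Equiv.ofBijective (fun b : B => ⟨⟨(b.1, c), hjoin b b.2 c hc,
        Or.inl ⟨b.2, hc⟩⟩, by simp⟩) ⟨fun b b' h => ?_, ?_⟩)
      · exact Subtype.ext (congrArg (fun d : {d : H.Dart // ¬ d.snd ≠ c} => d.1.fst) h)
      · rintro ⟨⟨⟨u, v⟩, ha⟩, hv⟩
        obtain rfl : v = c := by simpa using hv
        obtain ⟨-, ⟨h, -⟩ | ⟨h, -⟩ | h⟩ := ha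
        · exact ⟨⟨u, h⟩, rfl⟩
        · exact (hdis v h hc).elim
        · exact absurd rfl h.2.2.2
    rw [hB', ← Nat.card_sum]
    exact Nat.card_congr (Equiv.sumCompl _)
  rw [Finset.card_union_of_disjoint hBC] at hR
  have : 2 * B.card * C.card = B.card * C.card + C.card * B.card := by ring
  omega

end PlaneTorus

/-! ### Triangular embeddings and the rotation at a vertex. -/

namespace PlaneTorus

variable {V : Type*} {G : SimpleGraph V}

/-- The rotation at `a` has to leave every set of neighbours that is not the set of all
neighbours. -/
theorem RotationSystem.exists_next_notMem [Finite V] (R : RotationSystem G) {a x y : V}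
    {X : Set V} (hx : G.Adj a x) (hxX : x ∈ X) (hy : G.Adj a y) (hyX : y ∉ X) :
    ∃ d : G.Dart, d.fst = a ∧ d.snd ∈ X ∧ (R.next d).snd ∉ X := by
  by_contra hcon
  push Not at hcon
  have key : ∀ n : ℕ, ((R.next ^ n) ⟨(a, x), hx⟩).fst = a ∧
      ((R.next ^ n) ⟨(a, x), hx⟩).snd ∈ X := by
    intro n
    induction n with
    | zero => exact ⟨rfl, hxX⟩
    | succ n ih =>
      rw [pow_succ', Equiv.Perm.mul_apply]
      exact ⟨(R.fst_next _).trans ih.1, hcon _ ih.1 ih.2⟩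
  have hs : R.next.SameCycle ⟨(a, x), hx⟩ ⟨(a, y), hy⟩ := (R.sameCycle_iff _ _).2 rfl
  obtain ⟨n, -, hn⟩ := hs.exists_pow_eq'
  have := (key n).2
  rw [hn] at this
  exact hyX this

open Classical in
theorem card_darts_between [Fintype G.Dart] (X Y : Finset V) :
    (Finset.univ.filter fun d : G.Dart => d.fst ∈ X ∧ d.snd ∈ Y).card =
      ∑ x ∈ X, degIn G x Y := by
  simp only [degIn]
  rw [← Finset.card_sigma]
  refine Finset.card_bij (fun d _ => ⟨d.fst, d.snd⟩) (fun d hd => ?_) (fun d _ e _ h => ?_) ?_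
  · obtain ⟨h1, h2⟩ := (Finset.mem_filter.1 hd).2
    exact Finset.mem_sigma.2 ⟨h1, mem_nbrIn.2 ⟨h2, d.adj⟩⟩
  · simp only [Sigma.mk.injEq, heq_eq_eq] at h
    exact SimpleGraph.Dart.ext _ _ (Prod.ext h.1 h.2)
  · rintro ⟨x, y⟩ h
    obtain ⟨h1, h2⟩ := Finset.mem_sigma.1 h
    obtain ⟨h3, h4⟩ := mem_nbrIn.1 h2
    exact ⟨⟨(x, y), h4⟩, Finset.mem_filter.2 ⟨Finset.mem_univ _, h1, h3⟩, rfl⟩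

/-- In a triangular embedding, a vertex `a` of a triangle `A` cannot have neighbours in three
disjoint sets none of which has neighbours in the complement of `A`. -/
theorem RotationSystem.false_of_three_sides [Finite V] (R : RotationSystem G)
    (hR : ∀ d, R.facePerm (R.facePerm (R.facePerm d)) = d) {A : Finset V} (hA : A.card = 3)
    {a : V} (ha : a ∈ A) (hadj : ∀ b ∈ A, a ≠ b → G.Adj a b) (X : Fin 3 → Set V)
    (hX : Pairwise fun i j => Disjoint (X i) (X j)) (hXA : ∀ i, ∀ v ∈ A, v ∉ X i)
    (hclosed : ∀ i, ∀ v ∈ X i, ∀ w, G.Adj v w → w ∈ X i ∨ w ∈ A)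
    (hne : ∀ i, ∃ v ∈ X i, G.Adj a v) : False := by
  classical
  obtain ⟨b, hb, hba⟩ := Finset.exists_mem_ne (show 1 < A.card by omega) a
  -- Since faces are triangles, consecutive neighbours of `a` are adjacent, so the rotation can
  -- leave `X i` only into `A`.
  have hexit : ∀ i, ∃ d : G.Dart, d.fst = a ∧ d.snd ∈ X i ∧ (R.next d).snd ∈ A.erase a := by
    intro i
    obtain ⟨v, hv, hav⟩ := hne i
    obtain ⟨d, h1, h2, h3⟩ :=
      R.exists_next_notMem hav hv (hadj b hb hba.symm) (hXA i b hb)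
    have hf : (R.next d).fst = a := (R.fst_next d).trans h1
    refine ⟨d, h1, h2, Finset.mem_erase.2 ⟨fun h => (R.next d).fst_ne_snd (hf.trans h.symm), ?_⟩⟩
    have hadj' : G.Adj d.snd (R.next d).snd := by
      have h4 := hR d.symm
      have h5 : R.facePerm d.symm = R.next d := congrArg R.next d.symm_symm
      rw [h5] at h4
      have h6 := R.fst_facePerm (R.next d)
      have h7 := R.fst_facePerm (R.facePerm (R.next d))
      rw [h4] at h7
      have h8 := (R.facePerm (R.next d)).adj
      rw [h6, ← h7] at h8
      exact h8.symm
    exact (hclosed i _ h2 _ hadj').resolve_left h3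
  choose d h1 h2 h3 using hexit
  -- Equal exit vertices would mean equal preceding darts, whose ends lie in disjoint sets. Three
  -- exits do not fit into the two vertices of `A.erase a`.
  have hinj : Function.Injective fun i => (R.next (d i)).snd := by
    intro i j hij
    have : R.next (d i) = R.next (d j) := SimpleGraph.Dart.ext _ _
      (Prod.ext (by rw [R.fst_next, R.fst_next, h1, h1]) hij)
    have hd := R.next.injective this
    by_contra hne
    exact Set.disjoint_left.1 (hX hne) (h2 i) (hd ▸ h2 j)
  have hle := Finset.card_le_card_of_injOn (s := Finset.univ) (t := A.erase a) _
    (fun i _ => h3 i) hinj.injOn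
  rw [Finset.card_erase_of_mem ha, hA, Finset.card_univ, Fintype.card_fin] at hle
  omega

/-- If all darts from `A` to `C` are needed to bound the faces at the edges inside `C`, then some
edges inside `C` form a triangle. -/
theorem RotationSystem.exists_triangle [Finite V] (R : RotationSystem G)
    (hR : ∀ d, R.facePerm (R.facePerm (R.facePerm d)) = d) {A B C : Finset V}
    (hAC : Disjoint A C) (hcover : ∀ v, v ∈ A ∨ v ∈ B ∨ v ∈ C)
    (hBC : ∀ b ∈ B, ∀ c ∈ C, ¬ G.Adj b c)
    (hsum : ∑ a ∈ A, degIn G a C ≤ ∑ c ∈ C, degIn G c C) {a b c : V} (ha : a ∈ A)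
    (hb : b ∈ A) (hc : c ∈ C) (hab : G.Adj a b) (hac : G.Adj a c) :
    ∃ x ∈ C, ∃ y ∈ C, ∃ z ∈ C, G.Adj x y ∧ G.Adj y z ∧ G.Adj z x := by
  classical
  have := Fintype.ofFinite G.Dart
  by_contra hcon
  push Not at hcon
  set φ := R.facePerm with hφ
  rw [← card_darts_between, ← card_darts_between] at hsum
  set S := Finset.univ.filter fun d : G.Dart => d.fst ∈ C ∧ d.snd ∈ C
  set T := Finset.univ.filter fun d : G.Dart => d.fst ∈ A ∧ d.snd ∈ C
  -- The third vertex of a face at a dart inside `C` is not in `B` by `hBC` nor in `C` by `hcon`, so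
  -- the last dart of that face runs from `A` to `C`.
  have hmaps : S.image (fun d => φ (φ d)) ⊆ T := by
    intro e he
    obtain ⟨d, hd, rfl⟩ := Finset.mem_image.1 he
    obtain ⟨h1, h2⟩ := (Finset.mem_filter.1 hd).2
    have f1 : (φ d).fst = d.snd := R.fst_facePerm d
    have f2 : (φ (φ d)).fst = (φ d).snd := R.fst_facePerm _
    have f3 : (φ (φ d)).snd = d.fst := by
      have := R.fst_facePerm (φ (φ d))
      rw [← hφ, hR d] at this
      exact this.symm
    have a1 := (φ d).adj
    have a2 := (φ (φ d)).adj
    rw [f1, ← f2] at a1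
    rw [f3] at a2
    refine Finset.mem_filter.2 ⟨Finset.mem_univ _, ?_, f3 ▸ h1⟩
    rcases hcover (φ (φ d)).fst with h | h | h
    · exact h
    · exact absurd a2 (hBC _ h _ h1)
    · exact absurd a2 (hcon _ h1 _ h2 _ h d.adj a1)
  have hcard : (S.image fun d => φ (φ d)).card = S.card :=
    Finset.card_image_of_injective _ (φ.injective.comp φ.injective)
  have himage := Finset.eq_of_subset_of_card_le hmaps (hcard ▸ hsum)
  -- Where the rotation at `a` enters `C`, the preceding neighbour is outside `C`. Surjectivity onto
  -- `T` would place it inside `C`.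
  obtain ⟨d, h1, h2, h3⟩ := R.exists_next_notMem (X := {v | v ∉ C}) hab
    (Finset.disjoint_left.1 hAC hb) hac (fun h => h hc)
  have hdT : R.next d ∈ T := Finset.mem_filter.2
    ⟨Finset.mem_univ _, by rw [R.fst_next, h1]; exact ha, not_not.1 h3⟩
  rw [← himage] at hdT
  obtain ⟨e, he, hed⟩ := Finset.mem_image.1 hdT
  have : (φ e).symm = d := R.next.injective hed
  refine h2 ?_
  rw [← this]
  change (φ e).fst ∈ C
  rw [R.fst_facePerm]
  exact (Finset.mem_filter.1 he).2.2

/-- There is no triangular embedding of a graph in which `A` is a triangle that separates `B` from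
the six vertices of `C`, if `C` induces a graph that is regular of degree `2`. -/
theorem RotationSystem.false_of_separating [Finite V] (R : RotationSystem G)
    (hR : ∀ d, R.facePerm (R.facePerm (R.facePerm d)) = d) {A B C : Finset V}
    (hAB : Disjoint A B) (hAC : Disjoint A C) (hBC : Disjoint B C)
    (hcover : ∀ v, v ∈ A ∨ v ∈ B ∨ v ∈ C) (hA : G.IsNClique 3 A) (hC : C.card = 6)
    (hnadj : ∀ b ∈ B, ∀ c ∈ C, ¬ G.Adj b c)
    (hsum : ∑ a ∈ A, degIn G a C ≤ ∑ c ∈ C, degIn G c C)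
    (hdegC : ∀ c ∈ C, degIn G c C ≤ 2) (haC : ∀ a ∈ A, 4 ≤ degIn G a C)
    (haB : ∀ a ∈ A, 1 ≤ degIn G a B) : False := by
  classical
  have hA3 := hA.card_eq
  have hAadj : ∀ a ∈ A, ∀ b ∈ A, a ≠ b → G.Adj a b := fun a ha b hb hab => hA.isClique ha hb hab
  obtain ⟨a, ha⟩ : A.Nonempty := Finset.card_pos.1 (by omega)
  obtain ⟨b, hb, hba⟩ := Finset.exists_mem_ne (show 1 < A.card by omega) a
  obtain ⟨c, hc, hac⟩ := exists_adj_of_degIn_pos (show 0 < degIn G a C by have := haC a ha; omega)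
  obtain ⟨x, hx, y, hy, z, hz, hxy, hyz, hzx⟩ := R.exists_triangle hR hAC hcover hnadj hsum
    ha hb hc (hAadj a ha b hb hba.symm) hac
  have hnbr : ∀ u ∈ C, ∀ v ∈ C, ∀ w ∈ C, v ≠ w → G.Adj u v → G.Adj u w → ∀ t ∈ C, G.Adj u t →
      t = v ∨ t = w := by
    intro u hu v hv w hw hvw huv huw t ht hut
    have hsub : ({v, w} : Finset V) ⊆ nbrIn G u C := by
      intro s hs
      simp only [Finset.mem_insert, Finset.mem_singleton] at hs
      rcases hs with rfl | rfl
      · exact mem_nbrIn.2 ⟨hv, huv⟩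
      · exact mem_nbrIn.2 ⟨hw, huw⟩
    have heq := Finset.eq_of_subset_of_card_le hsub (by
      rw [Finset.card_pair hvw]; exact hdegC u hu)
    have : t ∈ nbrIn G u C := mem_nbrIn.2 ⟨ht, hut⟩
    rw [← heq] at this
    simpa using this
  set T : Finset V := {x, y, z} with hT
  have hT3 : T.card = 3 := Finset.card_eq_three.2 ⟨x, y, z, hxy.ne, hzx.ne', hyz.ne, rfl⟩
  have hTC : T ⊆ C := by
    intro v hv
    simp only [hT, Finset.mem_insert, Finset.mem_singleton] at hv
    rcases hv with rfl | rfl | rfl <;> assumption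
  have hTclosed : ∀ u ∈ T, ∀ v ∈ C, G.Adj u v → v ∈ T := by
    intro u hu v hv huv
    simp only [hT, Finset.mem_insert, Finset.mem_singleton] at hu ⊢
    rcases hu with rfl | rfl | rfl
    · have := hnbr u hx y hy z hz hyz.ne hxy hzx.symm v hv huv
      tauto
    · have := hnbr u hy x hx z hz hzx.ne' hxy.symm hyz v hv huv
      tauto
    · have := hnbr u hz x hx y hy hxy.ne hzx hyz.symm v hv huv
      tauto
  have hdis : Disjoint T (C \ T) := Finset.disjoint_sdiff
  have hT'3 : (C \ T).card = 3 := by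
    rw [Finset.card_sdiff_of_subset hTC, hC, hT3]
  -- Four neighbours in `C` cannot all lie in one of two sets of three, so `a` has neighbours in
  -- both.
  have hsplit : degIn G a T + degIn G a (C \ T) = degIn G a C := by
    rw [← degIn_union hdis, Finset.union_sdiff_of_subset hTC]
  have h4 := haC a ha
  have h5 := degIn_le_card (G := G) a T
  have h6 := degIn_le_card (G := G) a (C \ T)
  have hBT : Disjoint B T := hBC.mono_right hTC
  have hBT' : Disjoint B (C \ T) := hBC.mono_right Finset.sdiff_subset
  refine R.false_of_three_sides hR hA3 ha (hAadj a ha)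
    (fun i => (((![B, T, C \ T] : Fin 3 → Finset V) i : Finset V) : Set V)) ?_ ?_ ?_ ?_
  · intro i j hij
    rw [Finset.disjoint_coe]
    fin_cases i <;> fin_cases j <;> first | exact absurd rfl hij | skip
    · exact hBT
    · exact hBT'
    · exact hBT.symm
    · exact hdis
    · exact hBT'.symm
    · exact hdis.symm
  · intro i v hv
    have h1 := Finset.disjoint_left.1 hAB hv
    have h2 := Finset.disjoint_left.1 hAC hv
    fin_cases i
    · exact h1
    · exact fun h => h2 (hTC h)
    · exact fun h => h2 (Finset.mem_sdiff.1 h).1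
  · intro i v hv w hvw
    fin_cases i
    · rcases hcover w with h | h | h
      · exact Or.inr h
      · exact Or.inl h
      · exact absurd hvw (hnadj v hv w h)
    · rcases hcover w with h | h | h
      · exact Or.inr h
      · exact absurd hvw.symm (hnadj w h v (hTC hv))
      · exact Or.inl (hTclosed v hv w h hvw)
    · obtain ⟨hvC, hvT⟩ := Finset.mem_sdiff.1 hv
      rcases hcover w with h | h | h
      · exact Or.inr h
      · exact absurd hvw.symm (hnadj w h v hvC)
      · exact Or.inl (Finset.mem_sdiff.2 ⟨h, fun hw => hvT (hTclosed w hw v hvC hvw.symm)⟩)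
  · intro i
    fin_cases i
    · exact exists_adj_of_degIn_pos (haB a ha)
    · exact exists_adj_of_degIn_pos (show 0 < degIn G a T by omega)
    · exact exists_adj_of_degIn_pos (show 0 < degIn G a (C \ T) by omega)

end PlaneTorus

/-! ### The edge count that forces a triangulation. -/

open PlaneTorus in
theorem mainTheorem3 {V : Type*} [Fintype V] (G : SimpleGraph V) (hG : PlaneTorus.IsPT12 G) :
    ¬ ∃ A : Finset V,
      PlaneTorus.IsSeparatingTriangle G A ∧ PlaneTorus.DeletionLeaves G A 3 6 := by
  classical
  rintro ⟨A, ⟨hA, -⟩, B, C, hBC, hcov, hB, hC, hnadj⟩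
  obtain ⟨hV, hplanar, htorus⟩ := hG
  have hcover : ∀ v, v ∈ A ∨ v ∈ B ∨ v ∈ C := by
    intro v
    have := hcov v
    tauto
  have hAB : Disjoint A B := Finset.disjoint_left.2 fun v hv hb => (hcov v).2 (Or.inl hb) hv
  have hAC : Disjoint A C := Finset.disjoint_left.2 fun v hv hc => (hcov v).2 (Or.inr hc) hv
  have hA3 := hA.card_eq
  have hAadj : ∀ a ∈ A, ∀ b ∈ A, a ≠ b → G.Adj a b := fun a ha b hb hab => hA.isClique ha hb hab
  have hjoin : ∀ b ∈ B, ∀ c ∈ C, Gᶜ.Adj b c := fun b hb c hc =>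
    ⟨fun h => Finset.disjoint_left.1 hBC hb (h ▸ hc), hnadj b hb c hc⟩
  have hbC : ∀ b ∈ B, degIn Gᶜ b C = 6 := fun b hb => by rw [degIn_eq_card (hjoin b hb), hC]
  have hcB : ∀ c ∈ C, degIn Gᶜ c B = 3 := fun c hc => by
    rw [degIn_eq_card fun b hb => (hjoin b hb c hc).symm, hB]
  -- With d complement edges from `a` to `C`, the bipartite torus bound reads 18 + d + 4 ≤ 2 · 10 +
  -- 4, so d ≤ 2. The same inequality serves for `B` below.
  have haC : ∀ a ∈ A, 4 ≤ degIn G a C := by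
    intro a ha
    have haB : a ∉ B := Finset.disjoint_left.1 hAB ha
    have haC : a ∉ C := Finset.disjoint_left.1 hAC ha
    have h := degIn_add_degIn_compl_of_notMem (G := G) haC
    have hsum := htorus.sum_degIn_le_of_disjoint (X := B ∪ {a}) (Y := C)
      (Finset.disjoint_union_left.2 ⟨hBC, by simpa using haC⟩)
      (fun c hc => by rw [degIn_union (by simpa using haB), hcB c hc]; omega)
      (Finset.card_pos.1 (by omega))
    rw [sum_degIn_comm, Finset.sum_union (by simpa using haB), Finset.sum_congr rfl hbC,
      Finset.card_union_of_disjoint (by simpa using haB)] at hsum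
    simp only [Finset.sum_const, Finset.sum_singleton, Finset.card_singleton, smul_eq_mul,
      hB, hC] at hsum
    omega
  have haB : ∀ a ∈ A, 1 ≤ degIn G a B := by
    intro a ha
    have haB : a ∉ B := Finset.disjoint_left.1 hAB ha
    have haC : a ∉ C := Finset.disjoint_left.1 hAC ha
    have h := degIn_add_degIn_compl_of_notMem (G := G) haB
    have hsum := htorus.sum_degIn_le_of_disjoint (X := C ∪ {a}) (Y := B)
      (Finset.disjoint_union_left.2 ⟨hBC.symm, by simpa using haB⟩)
      (fun c hc => by rw [degIn_union (by simpa using haC), hbC c hc]; omega)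
      (Finset.card_pos.1 (by omega))
    rw [sum_degIn_comm, Finset.sum_union (by simpa using haC), Finset.sum_congr rfl hcB,
      Finset.card_union_of_disjoint (by simpa using haC)] at hsum
    simp only [Finset.sum_const, Finset.sum_singleton, Finset.card_singleton, smul_eq_mul,
      hB, hC] at hsum
    omega
  obtain ⟨b₀, hb₀⟩ : B.Nonempty := Finset.card_pos.1 (by omega)
  obtain ⟨a₀, ha₀⟩ : A.Nonempty := Finset.card_pos.1 (by omega)
  have hAA : ∀ a ∈ A, degIn G a A = 2 := by
    intro a ha
    have h := degIn_add_degIn_compl_of_mem (G := G) ha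
    have : degIn Gᶜ a A = 0 :=
      degIn_eq_zero fun b hb hab => hab.2 (hAadj a ha b hb hab.1)
    omega
  -- The torus bound on nine vertices is a degree sum of 54, of which K₃,₆ takes 36.
  have hBCsum : ∑ b ∈ B, degIn Gᶜ b B + ∑ c ∈ C, degIn Gᶜ c C ≤ 18 := by
    have hC1 : 1 < C.card := by omega
    obtain ⟨c, hc, c', hc', hcc⟩ := Finset.one_lt_card.1 hC1
    have h := htorus.sum_degIn_le (B ∪ C) ⟨b₀, Finset.mem_union_left _ hb₀, c,
      Finset.mem_union_right _ hc, c', Finset.mem_union_right _ hc', hcc, hjoin _ hb₀ _ hc,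
      hjoin _ hb₀ _ hc'⟩
    rw [Finset.sum_congr rfl fun v _ => degIn_union hBC v, Finset.sum_add_distrib,
      Finset.sum_union hBC, Finset.sum_union hBC, Finset.sum_congr rfl hbC,
      Finset.sum_congr rfl hcB, Finset.card_union_of_disjoint hBC] at h
    simp only [Finset.sum_const, smul_eq_mul, hB, hC] at h
    omega
  -- The planar bound on nine vertices is a degree sum of 42, of which the triangle takes 6.
  have hACsum : 2 * ∑ a ∈ A, degIn G a C + ∑ c ∈ C, degIn G c C ≤ 36 := by
    have hcard : 1 < (A.erase a₀).card := by rw [Finset.card_erase_of_mem ha₀]; omega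
    obtain ⟨u, hu, v, hv, huv⟩ := Finset.one_lt_card.1 hcard
    rw [Finset.mem_erase] at hu hv
    have h := hplanar.sum_degIn_le (A ∪ C) ⟨a₀, Finset.mem_union_left _ ha₀, u,
      Finset.mem_union_left _ hu.2, v, Finset.mem_union_left _ hv.2, huv,
      hAadj _ ha₀ _ hu.2 hu.1.symm, hAadj _ ha₀ _ hv.2 hv.1.symm⟩
    rw [Finset.sum_congr rfl fun v _ => degIn_union hAC v, Finset.sum_add_distrib,
      Finset.sum_union hAC, Finset.sum_union hAC, Finset.sum_congr rfl hAA,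
      sum_degIn_comm C A, Finset.card_union_of_disjoint hAC] at h
    simp only [Finset.sum_const, smul_eq_mul, hA3, hC] at h
    omega
  have hCcompl : ∑ c ∈ C, degIn G c C + ∑ c ∈ C, degIn Gᶜ c C = 30 := by
    rw [← Finset.sum_add_distrib, Finset.sum_congr rfl fun c hc => show _ = 5 by
      have := degIn_add_degIn_compl_of_mem (G := G) hc
      omega]
    simp [hC]
  have hACge : 12 ≤ ∑ a ∈ A, degIn G a C := by
    have := Finset.card_nsmul_le_sum _ _ _ haC
    rw [hA3] at this
    simpa using this
  -- The degree sums inside `C` are at most 36 - 2 · 12 = 12 in `G` and at most 18 in the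
  -- complement, and they add up to 30.
  have hCC : ∑ c ∈ C, degIn G c C = 12 := by omega
  have hBB : ∑ b ∈ B, degIn Gᶜ b B = 0 := by omega
  have hBindep : ∀ u ∈ B, ∀ v ∈ B, ¬ Gᶜ.Adj u v := by
    intro u hu v hv huv
    have h0 := Finset.sum_eq_zero_iff.1 hBB u hu
    have : v ∈ nbrIn Gᶜ u B := mem_nbrIn.2 ⟨hv, huv⟩
    rw [Finset.card_eq_zero.1 h0] at this
    simp at this
  -- With d the complement degree of `c` in `C`, the bound reads 36 + 18 + 12 + 6 ≤ 54 + 12 + 2d, so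
  -- d ≥ 3 out of 5.
  have hdegC : ∀ c ∈ C, degIn G c C ≤ 2 := by
    intro c hc
    have h := htorus.le_degIn_of_indep hBC (by omega) (by omega) hBindep hjoin hc
    have h1 := degIn_add_degIn_compl_of_mem (G := G) hc
    rw [hB, hC] at h
    omega
  have hdegC' : ∀ c ∈ C, degIn G c C = 2 := by
    refine (Finset.sum_eq_sum_iff_of_le hdegC).1 ?_
    rw [hCC, Finset.sum_const, hC]
    rfl
  have hmin : ∀ v, 2 ≤ degIn G v Finset.univ := by
    intro v
    have hmono : ∀ X : Finset V, degIn G v X ≤ degIn G v Finset.univ := fun X =>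
      Finset.card_le_card fun w hw => mem_nbrIn.2 ⟨Finset.mem_univ _, (mem_nbrIn.1 hw).2⟩
    rcases hcover v with h | h | h
    · exact (hAA v h).ge.trans (hmono A)
    · have h1 := degIn_add_degIn_compl_of_mem (G := G) h
      have h2 := Finset.sum_eq_zero_iff.1 hBB v h
      have h3 := hmono B
      omega
    · exact (hdegC' v h).ge.trans (hmono C)
  have hiso : NoIsolatedEdge G := by
    intro u v _
    obtain ⟨w, hw, hwv⟩ := Finset.exists_mem_ne (hmin u) v
    exact ⟨w, Or.inl ⟨hwv, (mem_nbrIn.1 hw).2⟩⟩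
  have hdarts : Nat.card Gᶜ.Dart ≤ 72 := by
    have hC1 : 1 < C.card := by omega
    obtain ⟨c, hc, c', hc', hcc⟩ := Finset.one_lt_card.1 hC1
    have h := htorus.sum_degIn_le Finset.univ ⟨b₀, Finset.mem_univ _, c, Finset.mem_univ _, c',
      Finset.mem_univ _, hcc, hjoin _ hb₀ _ hc, hjoin _ hb₀ _ hc'⟩
    rw [← card_dart_eq_sum_degIn Gᶜ _ fun _ _ _ => Finset.mem_univ _, Finset.card_univ, hV] at h
    omega
  have hdarts' : Nat.card G.Dart + Nat.card Gᶜ.Dart = 132 := by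
    rw [card_dart_eq_sum_degIn G Finset.univ fun _ _ _ => Finset.mem_univ _,
      card_dart_eq_sum_degIn Gᶜ Finset.univ fun _ _ _ => Finset.mem_univ _,
      ← Finset.sum_add_distrib, Finset.sum_congr rfl fun v hv => show _ = 11 by
        have := degIn_add_degIn_compl_of_mem (G := G) hv
        rw [Finset.card_univ, hV] at this
        omega]
    simp [hV]
  obtain ⟨c, -, hac⟩ := exists_adj_of_degIn_pos (haB a₀ ha₀)
  -- At least 132 - 72 = 60 darts remain for `G`, and 60 = 6 · 12 - 12 is the planar maximum.
  obtain ⟨R, hR⟩ := EmbedsInSurface.exists_triangular hplanar hiso ⟨_, _, hac⟩ (by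
    rw [Nat.card_eq_fintype_card, hV]
    omega)
  exact R.false_of_separating hR hAB hAC hBC hcover hA hC hnadj (by omega) hdegC haC haB
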